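/- Let $X$ be a set whose cardinality $|X|$ is an (infinite) singular cardinal. A partition on $X$ is a set partition $\alpha$ of $X\sqcup X'$, where $X'=\{x':x\in X\}$ is a disjoint copy of $X$; its parts are called blocks. The partition monoid $\mathcal P_X$ is the set of all partitions on $X$ with the following product. Given $\alpha,\beta\in\mathcal P_X$, relabel each lower vertex $x'$ of $\alpha$ and each upper vertex $x$ of $\beta$ as $x''$; then two elements of $X\sqcup X'$ lie in the same block of $\alpha\beta$ if and only if they are joined by a finite path in $X\sqcup X''\sqcup X'$ each of whose steps stays inside one block of the relabelled $\alpha$ or of the relabelled $\beta$. The identity is the partition with blocks $\{x,x'\}$ ($x\in X$). Let $\mathcal S_X$ be the group of units of $\mathcal P_X$ (a copy of the symmetric group on $X$), and for $\Sigma\subseteq\mathcal P_X$ let $\langle\Sigma\rangle$ be the subsemigroup generated by $\Sigma$. Let $\mathcal L_X$ be the set of all $\alpha\in\mathcal P_X$ such that every block meeting $X$ also meets $X'$ and distinct elements of $X$ lie in distinct blocks; let $\mathcal R_X$ be the set of all $\alpha\in\mathcal P_X$ such that every block meeting $X'$ also meets $X$ and distinct elements of $X'$ lie in distinct blocks. For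 $\alpha\in\mathcal P_X$ and a cardinal $\mu\le|X|$, define - $k(\alpha,\mu)$: the number of blocks $A$ meeting both $X$ and $X'$ with $|A\cap X|\ge\mu$; - $k^*(\alpha,\mu)$: the number of blocks $A$ meeting both $X$ and $X'$ with $|A\cap X'|\ge\mu$; - $d(\alpha,\mu)$: the number of blocks $A\subseteq X$ with $|A|\ge\mu$; - $d^*(\alpha,\mu)$: the number of blocks $A\subseteq X'$ with $|A|\ge\mu$; and put $d(\alpha)=d(\alpha,1)$, $d^*(\alpha)=d^*(\alpha,1)$. **Theorem.** Let $\alpha,\beta\in\mathcal P_X$. Then $\mathcal P_X=\langle\mathcal S_X\cup\{\alpha,\beta\}\rangle$ if and only if, after interchanging $\alpha$ and $\beta$ if necessary, $\alpha\in\mathcal L_X$, $\beta\in\mathcal R_X$, $d^*(\alpha)=d(\beta)=|X|$, and either (i) $k^*(\alpha,2)+d^*(\alpha,2)=|X|$ and $k(\beta,\mu)+d(\beta,\mu)=|X|$ for all cardinals $\mu<|X|$, or (ii) $k^*(\alpha,\mu)+d^*(\alpha,\mu)=|X|$ for all cardinals $\mu<|X|$, and $k(\beta,2)+d(\beta,2)=|X|$.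 -/

import Mathlib

universe u

/-- A partition on `X`: a partition of the disjoint union `X ⊔ X'` of two copies of `X`, given by
its equivalence relation. The upper vertex `x` is `Sum.inl x`, the lower vertex `x'` is
`Sum.inr x`; the blocks are the equivalence classes (`PartitionMonoid.blocks`). -/
@[ext]
structure PartitionMonoid (X : Type u) : Type u where
  /-- The equivalence relation "lies in the same block". -/
  rel : Setoid (X ⊕ X)

namespace PartitionMonoid

variable {X : Type u}

/-- The blocks of a partition. -/
def blocks (α : PartitionMonoid X) : Set (Set (X ⊕ X)) := α.rel.classes

/-- The upper part `A ∩ X` of a set `A ⊆ X ⊔ X'`, as a subset of `X`. -/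
def upperPart (A : Set (X ⊕ X)) : Set X := {x | Sum.inl x ∈ A}

/-- The lower part `A ∩ X'` of a set `A ⊆ X ⊔ X'`, as a subset of `X`. -/
def lowerPart (A : Set (X ⊕ X)) : Set X := {x | Sum.inr x ∈ A}

/-! ### Multiplication -/

/-- The vertex set `X ⊔ X'' ⊔ X'` of the product graph. -/
inductive ProductVertex (X : Type u) : Type u
  | up (x : X)
  | mid (x : X)
  | low (x : X)

/-- The vertices of the first factor, its lower row becoming the middle row. -/
def placeTop : X ⊕ X → ProductVertex X
  | Sum.inl x => ProductVertex.up x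
  | Sum.inr x => ProductVertex.mid x

/-- The vertices of the second factor, its upper row becoming the middle row. -/
def placeBottom : X ⊕ X → ProductVertex X
  | Sum.inl x => ProductVertex.mid x
  | Sum.inr x => ProductVertex.low x

/-- Adjacency in the product graph of `α` and `β`. -/
inductive ProductEdge (α β : PartitionMonoid X) : ProductVertex X → ProductVertex X → Prop
  | top {a b : X ⊕ X} (h : α.rel a b) : ProductEdge α β (placeTop a) (placeTop b)
  | bottom {a b : X ⊕ X} (h : β.rel a b) : ProductEdge α β (placeBottom a) (placeBottom b)

/-- The outer vertices `X ⊔ X'` of the product graph. -/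
def outer : X ⊕ X → ProductVertex X
  | Sum.inl x => ProductVertex.up x
  | Sum.inr x => ProductVertex.low x

theorem ProductEdge.symm {α β : PartitionMonoid X} {v w : ProductVertex X}
    (h : ProductEdge α β v w) : ProductEdge α β w v := by
  cases h with
  | top h => exact .top (α.rel.symm h)
  | bottom h => exact .bottom (β.rel.symm h)

/-- Being joined by a path in the product graph. -/
def productConn (α β : PartitionMonoid X) : Setoid (ProductVertex X) where
  r := Relation.ReflTransGen (ProductEdge α β)
  iseqv :=
    { refl := fun _ => .refl
      symm := fun h => by
        induction h with
        | refl => exact .refl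
        | tail _ e ih => exact .head e.symm ih
      trans := fun h₁ h₂ => h₁.trans h₂ }

/-- Two outer vertices lie in the same block of `α * β` if and only if there is a path between
them in the product graph. -/
instance : Mul (PartitionMonoid X) where
  mul α β := ⟨(productConn α β).comap outer⟩

/-- The identity has the blocks `{x, x'}`. -/
instance : One (PartitionMonoid X) where
  one := ⟨Setoid.ker (Sum.elim id id : X ⊕ X → X)⟩

theorem mul_rel (α β : PartitionMonoid X) (a b : X ⊕ X) :
    (α * β).rel a b ↔ Relation.ReflTransGen (ProductEdge α β) (outer a) (outer b) := Iff.rfl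

theorem one_rel (a b : X ⊕ X) :
    (1 : PartitionMonoid X).rel a b ↔ Sum.elim id id a = Sum.elim id id b := Iff.rfl

theorem mul_assoc_aux₁ (α β γ : PartitionMonoid X) (a b : X ⊕ X)
    (h : (α * β * γ).rel a b) : (α * (β * γ)).rel a b := by
  rw [mul_rel] at h ⊢
  let G : ProductVertex X → Prop :=
    Relation.ReflTransGen (ProductEdge α (β * γ)) (outer a)
  let Q : ProductVertex X → Prop := fun w =>
    ∃ c, G (placeBottom c) ∧ Relation.ReflTransGen (ProductEdge β γ) (outer c) w
  have hQ : ∀ {v w}, ProductEdge β γ v w → Q v → Q w :=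
    fun e ⟨c, h₁, h₂⟩ => ⟨c, h₁, h₂.tail e⟩
  have hQG : ∀ d, Q (outer d) ↔ G (placeBottom d) := fun d =>
    ⟨fun ⟨c, h₁, h₂⟩ => h₁.tail (.bottom (β := β * γ) h₂), fun h => ⟨d, h, .refl⟩⟩
  let R : ProductVertex X → Prop := fun
    | .up x => G (.up x)
    | .mid x => Q (.up x)
    | .low x => Q (.mid x)
  have hRtop : ∀ d, R (placeTop d) ↔ G (placeTop d) := by
    rintro (x | x)
    · exact Iff.rfl
    · exact hQG (.inl x)
  have hRbot : ∀ d, R (placeBottom d) ↔ Q (placeTop d) := by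
    rintro (x | x) <;> exact Iff.rfl
  have hR : ∀ {v w}, Relation.ReflTransGen (ProductEdge α β) v w → R v → R w := by
    intro v w p hv
    induction p with
    | refl => exact hv
    | tail _ e ih =>
      cases e with
      | top e => exact (hRtop _).2 (((hRtop _).1 ih).tail (.top e))
      | bottom e => exact (hRbot _).2 (hQ (.top e) ((hRbot _).1 ih))
  let W : ProductVertex X → Prop := fun
    | .up x => G (.up x)
    | .mid x => Q (.mid x)
    | .low x => Q (.low x)
  have hWtop : ∀ d, W (placeTop d) ↔ R (outer d) := by
    rintro (x | x) <;> exact Iff.rfl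
  have hWbot : ∀ d, W (placeBottom d) ↔ Q (placeBottom d) := by
    rintro (x | x) <;> exact Iff.rfl
  have hWG : ∀ d, W (outer d) ↔ G (outer d) := by
    rintro (x | x)
    · exact Iff.rfl
    · exact hQG (.inr x)
  refine (hWG b).1 ?_
  have h0 : W (outer a) := (hWG a).2 .refl
  generalize outer b = w at h
  induction h with
  | refl => exact h0
  | tail _ e ih =>
    cases e with
    | top e => exact (hWtop _).2 (hR e ((hWtop _).1 ih))
    | bottom e => exact (hWbot _).2 (hQ (.bottom e) ((hWbot _).1 ih))

theorem mul_assoc_aux₂ (α β γ : PartitionMonoid X) (a b : X ⊕ X)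
    (h : (α * (β * γ)).rel a b) : (α * β * γ).rel a b := by
  rw [mul_rel] at h ⊢
  let G : ProductVertex X → Prop :=
    Relation.ReflTransGen (ProductEdge (α * β) γ) (outer a)
  let Q : ProductVertex X → Prop := fun w =>
    ∃ c, G (placeTop c) ∧ Relation.ReflTransGen (ProductEdge α β) (outer c) w
  have hQ : ∀ {v w}, ProductEdge α β v w → Q v → Q w :=
    fun e ⟨c, h₁, h₂⟩ => ⟨c, h₁, h₂.tail e⟩
  have hQG : ∀ d, Q (outer d) ↔ G (placeTop d) := fun d =>
    ⟨fun ⟨c, h₁, h₂⟩ => h₁.tail (.top (α := α * β) h₂), fun h => ⟨d, h, .refl⟩⟩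
  let R : ProductVertex X → Prop := fun
    | .up x => Q (.mid x)
    | .mid x => Q (.low x)
    | .low x => G (.low x)
  have hRbot : ∀ d, R (placeBottom d) ↔ G (placeBottom d) := by
    rintro (x | x)
    · exact hQG (.inr x)
    · exact Iff.rfl
  have hRtop : ∀ d, R (placeTop d) ↔ Q (placeBottom d) := by
    rintro (x | x) <;> exact Iff.rfl
  have hR : ∀ {v w}, Relation.ReflTransGen (ProductEdge β γ) v w → R v → R w := by
    intro v w p hv
    induction p with
    | refl => exact hv
    | tail _ e ih =>
      cases e with
      | top e => exact (hRtop _).2 (hQ (.bottom e) ((hRtop _).1 ih))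
      | bottom e => exact (hRbot _).2 (((hRbot _).1 ih).tail (.bottom e))
  let W : ProductVertex X → Prop := fun
    | .up x => Q (.up x)
    | .mid x => Q (.mid x)
    | .low x => G (.low x)
  have hWtop : ∀ d, W (placeTop d) ↔ Q (placeTop d) := by
    rintro (x | x) <;> exact Iff.rfl
  have hWbot : ∀ d, W (placeBottom d) ↔ R (outer d) := by
    rintro (x | x) <;> exact Iff.rfl
  have hWG : ∀ d, W (outer d) ↔ G (outer d) := by
    rintro (x | x)
    · exact hQG (.inl x)
    · exact Iff.rfl
  refine (hWG b).1 ?_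
  have h0 : W (outer a) := (hWG a).2 .refl
  generalize outer b = w at h
  induction h with
  | refl => exact h0
  | tail _ e ih =>
    cases e with
    | top e => exact (hWtop _).2 (hQ (.top e) ((hWtop _).1 ih))
    | bottom e => exact (hWbot _).2 (hR e ((hWbot _).1 ih))

theorem one_mul_aux (α : PartitionMonoid X) (a b : X ⊕ X) :
    (1 * α).rel a b ↔ α.rel a b := by
  rw [mul_rel]
  let s : ProductVertex X → X ⊕ X := fun
    | .up x => .inl x
    | .mid x => .inl x
    | .low x => .inr x
  have hs : ∀ d, s (outer d) = d := by rintro (x | x) <;> rfl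
  have hs' : ∀ d, s (placeBottom d) = d := by rintro (x | x) <;> rfl
  have hs'' : ∀ d, s (placeTop d) = .inl (Sum.elim id id d) := by rintro (x | x) <;> rfl
  have hb : ∀ d, Relation.ReflTransGen (ProductEdge 1 α) (outer d) (placeBottom d) := by
    rintro (x | x)
    · exact .single (.top (α := 1) (a := .inl x) (b := .inr x) rfl)
    · exact .refl
  constructor
  · intro h
    have key : ∀ w, Relation.ReflTransGen (ProductEdge 1 α) (outer a) w → α.rel a (s w) := by
      intro w p
      induction p with
      | refl => exact (hs a).symm ▸ α.rel.refl a
      | tail _ e ih =>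
        cases e with
        | top e => rw [hs''] at ih ⊢; rw [← (one_rel _ _).1 e]; exact ih
        | bottom e => rw [hs'] at ih ⊢; exact α.rel.trans ih e
    have := key _ h
    rwa [hs] at this
  · intro h
    exact ((hb a).tail (.bottom h)).trans ((productConn 1 α).symm (hb b))

theorem mul_one_aux (α : PartitionMonoid X) (a b : X ⊕ X) :
    (α * 1).rel a b ↔ α.rel a b := by
  rw [mul_rel]
  let s : ProductVertex X → X ⊕ X := fun
    | .up x => .inl x
    | .mid x => .inr x
    | .low x => .inr x
  have hs : ∀ d, s (outer d) = d := by rintro (x | x) <;> rfl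
  have hs' : ∀ d, s (placeTop d) = d := by rintro (x | x) <;> rfl
  have hs'' : ∀ d, s (placeBottom d) = .inr (Sum.elim id id d) := by rintro (x | x) <;> rfl
  have hb : ∀ d, Relation.ReflTransGen (ProductEdge α 1) (outer d) (placeTop d) := by
    rintro (x | x)
    · exact .refl
    · exact .single (.bottom (β := 1) (a := .inr x) (b := .inl x) rfl)
  constructor
  · intro h
    have key : ∀ w, Relation.ReflTransGen (ProductEdge α 1) (outer a) w → α.rel a (s w) := by
      intro w p
      induction p with
      | refl => exact (hs a).symm ▸ α.rel.refl a
      | tail _ e ih =>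
        cases e with
        | top e => rw [hs'] at ih ⊢; exact α.rel.trans ih e
        | bottom e => rw [hs''] at ih ⊢; rw [← (one_rel _ _).1 e]; exact ih
    have := key _ h
    rwa [hs] at this
  · intro h
    exact ((hb a).tail (.top h)).trans ((productConn α 1).symm (hb b))

/-- The partition monoid on `X`. -/
instance : Monoid (PartitionMonoid X) where
  mul_assoc α β γ :=
    PartitionMonoid.ext (Setoid.ext fun a b =>
      ⟨mul_assoc_aux₁ α β γ a b, mul_assoc_aux₂ α β γ a b⟩)
  one_mul α := PartitionMonoid.ext (Setoid.ext (one_mul_aux α))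
  mul_one α := PartitionMonoid.ext (Setoid.ext (mul_one_aux α))

/-! ### Units, and the submonoids of left and right type -/

variable (X) in
/-- `S_X`: the group of units of the partition monoid, which is a copy of the symmetric group
on `X`. -/
def units : Set (PartitionMonoid X) := {π | IsUnit π}

/-- `dom α`: the points of `X` whose block meets `X'`. -/
def dom (α : PartitionMonoid X) : Set X := {x | ∃ y, α.rel (Sum.inl x) (Sum.inr y)}

/-- `codom α`: the points `x` of `X` for which the block of `x'` meets `X`. -/
def codom (α : PartitionMonoid X) : Set X := {x | ∃ y, α.rel (Sum.inr x) (Sum.inl y)}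

/-- `ker α`: the equivalence on `X` induced by the upper row. -/
def ker (α : PartitionMonoid X) : Setoid X := α.rel.comap Sum.inl

/-- `coker α`: the equivalence on `X` induced by the lower row. -/
def coker (α : PartitionMonoid X) : Setoid X := α.rel.comap Sum.inr

variable (X) in
/-- `L_X`: full domain and trivial kernel (`⊥` is the equality relation). -/
def leftSet : Set (PartitionMonoid X) := {α | α.dom = Set.univ ∧ α.ker = ⊥}

variable (X) in
/-- `R_X`: full codomain and trivial cokernel. -/
def rightSet : Set (PartitionMonoid X) := {α | α.codom = Set.univ ∧ α.coker = ⊥}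

/-! ### Cardinal parameters -/

/-- The transversal blocks: those meeting both `X` and `X'`. -/
def transversals (α : PartitionMonoid X) : Set (Set (X ⊕ X)) :=
  {A | A ∈ α.blocks ∧ (upperPart A).Nonempty ∧ (lowerPart A).Nonempty}

/-- The upper nontransversal blocks: those contained in `X`. -/
def upperNontransversals (α : PartitionMonoid X) : Set (Set (X ⊕ X)) :=
  {A | A ∈ α.blocks ∧ lowerPart A = ∅}

/-- The lower nontransversal blocks: those contained in `X'`. -/
def lowerNontransversals (α : PartitionMonoid X) : Set (Set (X ⊕ X)) :=
  {A | A ∈ α.blocks ∧ upperPart A = ∅}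

/-- `k(α, μ)`: the number of transversal blocks whose upper part has size at least `μ`. -/
noncomputable def k (α : PartitionMonoid X) (μ : Cardinal.{u}) : Cardinal.{u} :=
  Cardinal.mk {A // A ∈ α.transversals ∧ μ ≤ Cardinal.mk (upperPart A)}

/-- `k*(α, μ)`: the number of transversal blocks whose lower part has size at least `μ`. -/
noncomputable def kStar (α : PartitionMonoid X) (μ : Cardinal.{u}) : Cardinal.{u} :=
  Cardinal.mk {A // A ∈ α.transversals ∧ μ ≤ Cardinal.mk (lowerPart A)}

/-- `d(α, μ)`: the number of upper nontransversal blocks of size at least `μ`. -/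
noncomputable def d (α : PartitionMonoid X) (μ : Cardinal.{u}) : Cardinal.{u} :=
  Cardinal.mk {A // A ∈ α.upperNontransversals ∧ μ ≤ Cardinal.mk (upperPart A)}

/-- `d*(α, μ)`: the number of lower nontransversal blocks of size at least `μ`. -/
noncomputable def dStar (α : PartitionMonoid X) (μ : Cardinal.{u}) : Cardinal.{u} :=
  Cardinal.mk {A // A ∈ α.lowerNontransversals ∧ μ ≤ Cardinal.mk (lowerPart A)}

end PartitionMonoid

section

/-! ### Cofinal families of cardinals and injective choices. -/

open Cardinal Set

/-! Sufficiency. With a permutation `σ` in between, the product graph of `α σ β` is a bipartite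
multigraph: its vertices are the blocks of `α` and of `β`, its edges the middle points. For `α ∈
L_X` and `β ∈ R_X` every block carries an edge, and the upper points of `α` and the lower points of
`β` lie in distinct blocks. To obtain a given `γ`, colour the blocks of both factors by the blocks
of `γ`, as prescribed at the outer points (`exists_coloring`), and choose `σ` so that each colour
class is one component (`exists_connected_matching`, `exists_eq_mul`). Singularity enters here:
fewer than `|X|` blocks of `β` ("hubs"), of cofinal sizes, together offer `|X|` edges, enough to
catch every block of `α`; being few, the hubs can be tied to a single centre through blocks of `α`
with two lower points. This needs large nontransversal blocks. If only large transversals are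
available, `exists_le_d_mul` produces them by closing off these transversals with nontransversals of
a second copy of `β`.

Necessity. Each condition comes from a property that holds for units, survives products and fails
for some partition. If neither generator were a nonunit of `L_X`, then `L_X` would consist of units;
dually for `R_X`. The other properties say that fewer than `|X|` points meet all upper
nontransversals (`SmallDefect`) or all large kernel classes (`SmallKer`). For large thresholds a
product may raise the threshold to its successor (`SmallKer.mul_succ`), which stays below `|X|`
because `|X|` is a limit cardinal. -/

theorem Cardinal.IsSingular.exists_cofinal_family {c : Cardinal.{u}} (hc : c.IsSingular) :
    ∃ (I : Type u) (m : I → Cardinal.{u}), #I < c ∧ (∀ i, m i < c) ∧ ∀ ν < c, ∃ i, ν ≤ m i := by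
  obtain ⟨s, hs, hcard⟩ := Order.exists_cof_eq c.ord.ToType
  refine ⟨s, fun i => (i.1.toOrd : Ordinal.{u}).card, ?_, fun i => ?_, fun ν hν => ?_⟩
  · rw [hcard, Ordinal.cof_toType]; exact hc.cof_ord_lt
  · exact Cardinal.lt_ord.1 i.1.toOrd.2
  · obtain ⟨i, his, hi⟩ := hs (Ordinal.ToType.mk ⟨ν.ord, Cardinal.ord_lt_ord.2 hν⟩)
    refine ⟨⟨i, his⟩, ?_⟩
    have h := Ordinal.ToType.mk.symm.monotone hi
    rw [OrderIso.symm_apply_apply] at h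
    have h' := Ordinal.card_le_card (Subtype.coe_le_coe.2 h)
    simpa using h'

/-- A family of at most `κ` sets, each with at least `κ` elements, has an injective choice. -/
theorem exists_injective_choice {κ : Cardinal.{u}} {T V : Type u} (hT : #T ≤ κ)
    (S : T → Set V) (hS : ∀ t, κ ≤ #(S t)) :
    ∃ φ : T → V, Function.Injective φ ∧ ∀ t, φ t ∈ S t := by
  obtain ⟨e⟩ : Nonempty ((#T).ord.ToType ≃ T) := Cardinal.eq.1 (by simp)
  -- In the initial well-order of `T` each proper initial segment has fewer than `κ` elements, so
  -- the earlier choices never exhaust the next set.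
  have key : ∀ (t : (#T).ord.ToType) (g : Iio t → V), ∃ v ∈ S (e t), v ∉ range g := by
    intro t g
    by_contra! hcon
    have h1 : #(S (e t)) ≤ #(range g) := mk_le_mk_of_subset hcon
    have h2 : #(Iio t) < #(#T).ord.ToType := Cardinal.mk_Iio_lt t (by simp)
    rw [mk_ord_toType] at h2
    exact absurd ((hS _).trans (h1.trans mk_range_le)) (not_le.2 (h2.trans_le hT))
  choose F hF hF' using key
  let φ : (#T).ord.ToType → V :=
    wellFounded_lt.fix fun t ih => F t fun y => ih y.1 y.2
  have hφ : ∀ t, φ t = F t fun y => φ y.1 := fun t => wellFounded_lt.fix_eq _ t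
  have hne : ∀ s t, s < t → φ s ≠ φ t := by
    intro s t hst h
    rw [hφ t] at h
    exact hF' t (fun y => φ y.1) ⟨⟨s, hst⟩, h⟩
  refine ⟨fun t => φ (e.symm t), ?_, fun t => ?_⟩
  · intro a b hab
    by_contra hne'
    rcases lt_or_gt_of_ne (fun h => hne' (e.symm.injective h)) with h | h
    · exact hne _ _ h hab
    · exact hne _ _ h hab.symm
  · have := hF (e.symm t) (fun y => φ y.1)
    rw [e.apply_symm_apply] at this
    show φ (e.symm t) ∈ S t
    rw [hφ]
    exact this

/-- Two injections with equipotent complements are conjugate under a bijection. -/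
theorem exists_equiv_extending {Z E F : Type u} {δ : Z → E} {τ : Z → F}
    (hδ : Function.Injective δ) (hτ : Function.Injective τ)
    (h : #↥(range δ)ᶜ = #↥(range τ)ᶜ) : ∃ σ : E ≃ F, ∀ z, σ (δ z) = τ z := by
  classical
  obtain ⟨e⟩ := Cardinal.eq.1 h
  let e₁ : Z ≃ range δ := Equiv.ofInjective δ hδ
  let e₂ : Z ≃ range τ := Equiv.ofInjective τ hτ
  refine ⟨(Equiv.Set.sumCompl (range δ)).symm.trans
    ((Equiv.sumCongr (e₁.symm.trans e₂) e).trans (Equiv.Set.sumCompl (range τ))), fun z => ?_⟩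
  have h1 : (Equiv.Set.sumCompl (range δ)).symm (δ z) = Sum.inl (e₁ z) :=
    Equiv.Set.sumCompl_symm_apply_of_mem (mem_range_self z)
  simp [h1, e₂]

theorem le_mk_diff {E : Type u} {κ : Cardinal.{u}} (hκ : ℵ₀ ≤ κ) {A B : Set E}
    (hA : κ ≤ #A) (hB : #B < κ) : κ ≤ #↥(A \ B) := by
  by_contra! h
  have h1 : #A ≤ #↥(A \ B) + #B := le_mk_sdiff_add_mk A B
  exact absurd (hA.trans h1) (not_le.2 (add_lt_of_lt hκ h hB))

theorem exists_embedding_sum {E X : Type u} (hX : ℵ₀ ≤ #X) {H : Set E} (hH : #X ≤ #H) :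
    ∃ b : X ⊕ X → E, Function.Injective b ∧ ∀ z, b z ∈ H := by
  have : #(X ⊕ X) ≤ #H := by
    rw [mk_sum, lift_id, add_eq_self hX]; exact hH
  obtain ⟨b⟩ := this
  exact ⟨fun z => (b z).1, fun _ _ h => b.injective (Subtype.ext h), fun z => (b z).2⟩

/-! ### Connected matchings, uncoloured and coloured. -/

/-- Given two surjections with sufficiently many large fibres, their domains can be matched so
that the bipartite multigraph with the matched pairs as edges is connected. -/
theorem exists_connected_matching {X E F L R : Type u} (hX : (#X).IsSingular)
    (hE : #E ≤ #X) (hF : #F ≤ #X) {h : E → L} (hh : Function.Surjective h) {f : F → R}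
    (hf : Function.Surjective f)
    (hL : #X ≤ #{l | ∃ e e', e ≠ e' ∧ h e = l ∧ h e' = l})
    (hR : ∀ μ < #X, #X ≤ #{r | μ ≤ #{x // f x = r}}) :
    ∃ σ : E ≃ F, ∀ {Y : Type u} (φ : L → Y) (ψ : R → Y), (∀ e, φ (h e) = ψ (f (σ e))) →
      ∀ l r, φ l = ψ r := by
  classical
  have hinf := hX.aleph0_le
  obtain ⟨I, m, hI, hm, hcof⟩ := hX.exists_cofinal_family
  -- the hubs and the centre
  obtain ⟨W, hWinj, hW⟩ := exists_injective_choice (κ := #X) (T := Option I) (V := R)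
    (by rw [mk_option]; exact (add_lt_of_lt hinf hI (one_lt_aleph0.trans_le hinf)).le)
    -- `none` is the centre, `some i` a hub. The centre only has to supply one edge per hub, hence
    -- the threshold `#I`.
    (fun o => {r | (o.elim (#I) m) ≤ #{x // f x = r}})
    (by rintro (_ | i); exacts [hR _ hI, hR _ (hm i)])
  obtain ⟨s⟩ : Nonempty (I ↪ {x // f x = W none}) := hW none
  choose t ht using fun i => hf (W (some i))
  have htinj : Function.Injective t := fun a b hab => by
    have := hWinj ((ht a).symm.trans ((congrArg f hab).trans (ht b)))
    simpa using this
  -- representative edges and second edges of left vertices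
  let rep : L → E := Function.surjInv hh
  have hrep : ∀ l, h (rep l) = l := Function.surjInv_eq hh
  have hrepinj : Function.Injective rep := Function.injective_surjInv hh
  set L₂ : Set L := {l | ∃ e e', e ≠ e' ∧ h e = l ∧ h e' = l} with hL₂
  have hsec : ∀ l : L₂, ∃ e, h e = l ∧ e ≠ rep l := by
    rintro ⟨l, e, e', hne, he, he'⟩
    by_cases hc : e = rep l
    · exact ⟨e', he', fun h' => hne (hc.trans h'.symm)⟩
    · exact ⟨e, he, hc⟩
  choose e₂ he₂ he₂' using hsec
  have he₂inj : Function.Injective e₂ := fun a b hab => by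
    apply Subtype.ext; rw [← he₂ a, ← he₂ b, hab]
  have he₂rep : ∀ l l', e₂ l ≠ rep l' := fun l l' hc => by
    have h1 : (l : L) = l' := by rw [← he₂ l, hc, hrep]
    exact he₂' l (by rw [hc, h1])
  obtain ⟨j⟩ : Nonempty (I ↪ L₂) := (hI.le.trans hL)
  -- hub edges
  set H : Set F := {x | ∃ i, f x = W (some i)} \ range t with hH
  have hHcard : #X ≤ #H := by
    refine le_mk_diff hinf ?_ (mk_range_le.trans_lt hI)
    -- If the hubs had fewer than `#X` edges in all, the successor of that number would still be
    -- below `#X`, and a single hub would exceed the total.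
    by_contra! hlt
    obtain ⟨i, hi⟩ := hcof _ (hX.isSuccLimit.succ_lt hlt)
    have h1 : #{x // f x = W (some i)} ≤ #{x | ∃ i, f x = W (some i)} :=
      mk_le_mk_of_subset (s := {x | f x = W (some i)}) fun x hx => ⟨i, hx⟩
    exact absurd (((hW (some i)).trans h1)) (not_le.2 ((Order.lt_succ _).trans_le hi))
  -- The `inl` copy receives the left vertices outside the range of `j`; the `inr` copy stays
  -- unused, so that the complement of the prescribed part has size `#X`.
  obtain ⟨b, hbinj, hb⟩ := exists_embedding_sum hinf hHcard
  obtain ⟨ℓ⟩ : Nonempty (L ↪ X) := ((mk_le_of_surjective hh).trans hE)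
  -- the prescribed part of the matching
  let Z := {l : L // ∀ i, (j i : L) ≠ l} ⊕ I ⊕ I
  -- Each `j i` sends one edge to the centre and a second to hub `i`; all other left vertices hang
  -- from some hub.
  let δ : Z → E := Sum.elim (fun l => rep l) (Sum.elim (fun i => rep (j i)) (fun i => e₂ (j i)))
  let τ : Z → F := Sum.elim (fun l => b (.inl (ℓ l))) (Sum.elim (fun i => s i) t)
  have hδ : Function.Injective δ := by
    refine Function.Injective.sumElim (fun a b hab => Subtype.ext (hrepinj hab))
      (Function.Injective.sumElim
        (fun a b hab => j.injective (Subtype.ext (hrepinj hab)))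
        (fun a b hab => j.injective (he₂inj hab))
        (fun a b hab => he₂rep _ _ hab.symm)) ?_
    rintro ⟨l, hl⟩ (i | i) hab
    · exact hl i (hrepinj hab).symm
    · exact he₂rep _ _ hab.symm
  have hbs : ∀ z i, b z ≠ s i := fun z i hc => by
    obtain ⟨⟨i', hi'⟩, -⟩ := hb z
    rw [hc, (s i).2] at hi'
    exact absurd (hWinj hi') (by simp)
  have hbt : ∀ z i, b z ≠ t i := fun z i hc => (hb z).2 ⟨i, hc.symm⟩
  have hst : ∀ i i', (s i : F) ≠ t i' := fun i i' hc => by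
    have := (s i).2
    rw [hc, ht] at this
    exact absurd (hWinj this) (by simp)
  have hτ : Function.Injective τ := by
    refine Function.Injective.sumElim
      (fun a b hab => Subtype.ext (ℓ.injective (Sum.inl_injective (hbinj hab))))
      (Function.Injective.sumElim
        (fun a b hab => s.injective (Subtype.ext hab)) htinj (fun a b => hst a b)) ?_
    rintro l (i | i)
    exacts [hbs _ _, hbt _ _]
  have hδc : #↥(range δ)ᶜ = #X := by
    refine le_antisymm ((mk_set_le _).trans hE) ?_
    have h1 : #X ≤ #↥(range e₂ \ range fun i => e₂ (j i)) :=
      le_mk_diff hinf (by rw [mk_range_eq _ he₂inj]; exact hL) (mk_range_le.trans_lt hI)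
    refine h1.trans (mk_le_mk_of_subset ?_)
    rintro _ ⟨⟨l, rfl⟩, hl⟩ ⟨l' | i | i, hz⟩
    exacts [he₂rep _ _ hz.symm, he₂rep _ _ hz.symm, hl ⟨i, hz⟩]
  have hτc : #↥(range τ)ᶜ = #X := by
    refine le_antisymm ((mk_set_le _).trans hF) ?_
    have h1 : #(range fun x => b (.inr x)) = #X :=
      mk_range_eq _ (hbinj.comp Sum.inr_injective)
    rw [← h1]
    refine mk_le_mk_of_subset ?_
    rintro _ ⟨x, rfl⟩ ⟨l | i | i, hz⟩
    exacts [absurd (hbinj hz) (by simp), hbs _ _ hz.symm, hbt _ _ hz.symm]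
  obtain ⟨σ, hσ⟩ := exists_equiv_extending hδ hτ (hδc.trans hτc.symm)
  refine ⟨σ, fun {Y} φ ψ hc => ?_⟩
  have hσs : ∀ i, φ (j i) = ψ (W none) := fun i => by
    have h1 := hc (δ (.inr (.inl i)))
    rw [hσ] at h1
    have h2 : f (τ (.inr (.inl i))) = W none := (s i).2
    rwa [h2, show h (δ (.inr (.inl i))) = j i from hrep _] at h1
  have hhub : ∀ i, ψ (W (some i)) = ψ (W none) := fun i => by
    have h1 := hc (δ (.inr (.inr i)))
    rw [hσ, show f (τ (.inr (.inr i))) = W (some i) from ht i,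
      show h (δ (.inr (.inr i))) = j i from he₂ _, hσs] at h1
    exact h1.symm
  have hleft : ∀ l, φ l = ψ (W none) := fun l => by
    by_cases hl : ∀ i, (j i : L) ≠ l
    · have h1 := hc (δ (.inl ⟨l, hl⟩))
      obtain ⟨⟨i, hi⟩, -⟩ := hb (.inl (ℓ l))
      rw [hσ, show f (τ (.inl ⟨l, hl⟩)) = W (some i) from hi,
        show h (δ (.inl ⟨l, hl⟩)) = l from hrep _, hhub] at h1
      exact h1
    · push Not at hl
      obtain ⟨i, rfl⟩ := hl
      exact hσs i
  intro l r
  -- Every right vertex has an edge, and its left end is already joined to the centre.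
  obtain ⟨x, rfl⟩ := hf r
  obtain ⟨e, rfl⟩ := σ.surjective x
  rw [hleft, ← hc, hleft]

/-- Extend a colouring along an injection so that each colour is used `#X` times on each of a
family of large sets outside the range. -/
theorem exists_coloring {X V C I : Type u} (hX : ℵ₀ ≤ #X) (hC : #C ≤ #X) [Nonempty C]
    (hI : #I ≤ #X) {i : X → V} (hi : Function.Injective i) (g : X → C) (S : I → Set V)
    (hSi : ∀ t x, i x ∉ S t) (hS : ∀ t, #X ≤ #(S t)) :
    ∃ c : V → C, (∀ x, c (i x) = g x) ∧ ∀ t a, #X ≤ #{v | v ∈ S t ∧ c v = a} := by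
  classical
  have hT : #((C × X) × I) ≤ #X := by
    rw [mk_prod, mk_prod]
    simp only [lift_id]
    exact (mul_le_mul' (mul_le_mul' hC le_rfl) hI).trans
      (by rw [mul_eq_self hX, mul_eq_self hX])
  obtain ⟨φ, hφ, hφS⟩ := exists_injective_choice hT (fun t => S t.2) (fun t => hS t.2)
  let c : V → C := fun v =>
    if h : ∃ x, i x = v then g h.choose
    else if h : ∃ t, φ t = v then h.choose.1.1 else Classical.arbitrary C
  have hcφ : ∀ t, c (φ t) = t.1.1 := fun t => by
    have h1 : ¬ ∃ x, i x = φ t := fun ⟨x, hx⟩ => hSi t.2 x (hx ▸ hφS t)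
    have h2 : ∃ t', φ t' = φ t := ⟨t, rfl⟩
    simp only [c, dif_neg h1, dif_pos h2]
    rw [hφ h2.choose_spec]
  refine ⟨c, fun x => ?_, fun t a => ?_⟩
  · have h1 : ∃ x', i x' = i x := ⟨x, rfl⟩
    simp only [c, dif_pos h1]
    rw [hi h1.choose_spec]
  · have h1 : #(range fun x => φ ((a, x), t)) = #X :=
      mk_range_eq _ fun x y hxy => by simpa using hφ hxy
    rw [← h1]
    refine mk_le_mk_of_subset ?_
    rintro _ ⟨x, rfl⟩
    exact ⟨hφS ((a, x), t), hcφ _⟩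

/-- Each colour class separately satisfies the hypotheses of `exists_connected_matching`, since all
edges at a vertex take its colour; the bijections found there glue to a permutation of `X`. -/
theorem exists_connected_colored_matching {X V W C : Type u} (hX : (#X).IsSingular)
    {h : X → V} (hh : Function.Surjective h) {f : X → W} (hf : Function.Surjective f)
    (cV : V → C) (cW : W → C)
    (hV : ∀ a, #X ≤ #{v | v ∈ {v | ∃ e e', e ≠ e' ∧ h e = v ∧ h e' = v} ∧ cV v = a})
    (hW : ∀ μ < #X, ∀ a, #X ≤ #{w | w ∈ {w | μ ≤ #{x // f x = w}} ∧ cW w = a}) :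
    ∃ σ : X ≃ X, (∀ e, cW (f (σ e)) = cV (h e)) ∧
      ∀ {Y : Type u} (φ : V → Y) (ψ : W → Y), (∀ e, φ (h e) = ψ (f (σ e))) →
        ∀ v w, cV v = cW w → φ v = ψ w := by
  have key : ∀ a : C, ∃ σ : {e // cV (h e) = a} ≃ {x // cW (f x) = a},
      ∀ {Y : Type u} (φ : {v // cV v = a} → Y) (ψ : {w // cW w = a} → Y),
        (∀ e, φ ⟨h e.1, e.2⟩ = ψ ⟨f (σ e).1, (σ e).2⟩) → ∀ l r, φ l = ψ r := by
    intro a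
    refine exists_connected_matching hX (mk_subtype_le _) (mk_subtype_le _)
      (h := fun e : {e // cV (h e) = a} => (⟨h e.1, e.2⟩ : {v // cV v = a}))
      (f := fun x : {x // cW (f x) = a} => (⟨f x.1, x.2⟩ : {w // cW w = a})) ?_ ?_ ?_ ?_
    · rintro ⟨v, hv⟩
      obtain ⟨e, rfl⟩ := hh v
      exact ⟨⟨e, hv⟩, rfl⟩
    · rintro ⟨v, hv⟩
      obtain ⟨e, rfl⟩ := hf v
      exact ⟨⟨e, hv⟩, rfl⟩
    · refine (hV a).trans (mk_le_of_injective (f := fun v => ⟨⟨v.1, v.2.2⟩, ?_⟩) ?_)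
      · obtain ⟨v, ⟨e, e', hne, he, he'⟩, hv⟩ := v
        exact ⟨⟨e, he ▸ hv⟩, ⟨e', he' ▸ hv⟩, fun hc => hne (congrArg Subtype.val hc),
          Subtype.ext he, Subtype.ext he'⟩
      · intro v w hvw
        exact Subtype.ext (congrArg (fun z => z.1.1) hvw)
    · intro μ hμ
      refine (hW μ hμ a).trans (mk_le_of_injective (f := fun v => ⟨⟨v.1, v.2.2⟩, ?_⟩) ?_)
      · obtain ⟨w, hw, hwa⟩ := v
        refine le_trans hw (mk_le_of_injective
          (f := fun x => ⟨⟨x.1, (congrArg cW x.2).trans hwa⟩, Subtype.ext x.2⟩) ?_)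
        intro x y hxy
        exact Subtype.ext (congrArg (fun z => z.1.1) hxy)
      · intro v w hvw
        exact Subtype.ext (congrArg (fun z => z.1.1) hvw)
  choose σ hσ using key
  let e : X ≃ X := (Equiv.sigmaFiberEquiv fun x => cV (h x)).symm.trans
    ((Equiv.sigmaCongrRight σ).trans (Equiv.sigmaFiberEquiv fun x => cW (f x)))
  have he : ∀ a (x : {e // cV (h e) = a}), e x.1 = (σ a x).1 := by
    rintro _ ⟨x, rfl⟩
    rfl
  refine ⟨e, fun x => ?_, fun {Y} φ ψ hc v w hvw => ?_⟩
  · rw [he _ ⟨x, rfl⟩]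
    exact (σ _ ⟨x, rfl⟩).2
  · exact hσ (cW w) (fun v => φ v.1) (fun w => ψ w.1)
      (fun x => by rw [hc, he _ x]) ⟨v, hvw⟩ ⟨w, rfl⟩

/-! ### Size of a connected component. -/

/-- The reachable set is a countable union of sets of endpoints of `n`-step paths. Degrees are
bounded only at reachable vertices, because the application is to components that avoid the
exceptional large blocks. -/
theorem Cardinal.mk_reflTransGen_le {V : Type u} {r : V → V → Prop} {μ : Cardinal.{u}}
    (hμ : Cardinal.aleph0 ≤ μ) (a : V)
    (h : ∀ v, Relation.ReflTransGen r a v → Cardinal.mk {w | r v w} ≤ μ) :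
    Cardinal.mk {w | Relation.ReflTransGen r a w} ≤ μ := by
  let F : Set V → Set V := fun s => ⋃ v ∈ s, {w | r v w}
  let N : ℕ → Set V := fun n => F^[n] {a}
  have hN : ∀ n, N (n + 1) = ⋃ v ∈ N n, {w | r v w} :=
    fun n => Function.iterate_succ_apply' F n {a}
  have hsub : ∀ n, N n ⊆ {w | Relation.ReflTransGen r a w} := by
    intro n
    induction n with
    | zero =>
      intro w hw
      rw [show w = a from hw]
      exact .refl
    | succ n ih =>
      intro w hw
      rw [hN] at hw
      obtain ⟨v, hv, hvw⟩ := Set.mem_iUnion₂.1 hw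
      exact (ih hv).tail hvw
  have hcard : ∀ n, Cardinal.mk (N n) ≤ μ := by
    intro n
    induction n with
    | zero => exact (Cardinal.mk_singleton a).le.trans (Cardinal.one_le_aleph0.trans hμ)
    | succ n ih =>
      rw [hN]
      refine (Cardinal.mk_biUnion_le _ _).trans ?_
      refine (mul_le_mul' ih (ciSup_le' fun v => h _ (hsub n v.2))).trans ?_
      exact (Cardinal.mul_eq_self hμ).le
  have hcover : {w | Relation.ReflTransGen r a w} ⊆ ⋃ n, N n := by
    intro w hw
    induction hw with
    | refl => exact Set.mem_iUnion.2 ⟨0, rfl⟩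
    | tail _ e ih =>
      obtain ⟨n, hn⟩ := Set.mem_iUnion.1 ih
      exact Set.mem_iUnion.2 ⟨n + 1, (hN n).symm ▸ Set.mem_iUnion₂.2 ⟨_, hn, e⟩⟩
  refine (Cardinal.mk_le_mk_of_subset hcover).trans ?_
  have h1 := Cardinal.mk_iUnion_le_lift.{u, 0} N
  rw [Cardinal.lift_uzero, Cardinal.mk_nat, Cardinal.lift_aleph0] at h1
  refine h1.trans ((mul_le_mul' hμ (ciSup_le' fun n => ?_)).trans (Cardinal.mul_eq_self hμ).le)
  simpa using hcard n

namespace PartitionMonoid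

variable {X : Type u}

/-! ### Products, permutations and the involution -/

/-- A set of vertices of the product graph that is closed under both factors is closed under the
product. -/
theorem mul_rel_induction {α β : PartitionMonoid X} (Q : ProductVertex X → Prop)
    (htop : ∀ a b, α.rel a b → Q (placeTop a) → Q (placeTop b))
    (hbot : ∀ a b, β.rel a b → Q (placeBottom a) → Q (placeBottom b)) {v w : ProductVertex X}
    (h : productConn α β v w) (hv : Q v) : Q w := by
  change Relation.ReflTransGen _ _ _ at h
  induction h with
  | refl => exact hv
  | tail _ e ih =>
    cases e with
    | top e => exact htop _ _ e ih
    | bottom e => exact hbot _ _ e ih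

theorem conn_top {α : PartitionMonoid X} (β : PartitionMonoid X) {a b : X ⊕ X} (h : α.rel a b) :
    productConn α β (placeTop a) (placeTop b) :=
  Relation.ReflTransGen.single (.top h)

theorem conn_bottom (α : PartitionMonoid X) {β : PartitionMonoid X} {a b : X ⊕ X}
    (h : β.rel a b) : productConn α β (placeBottom a) (placeBottom b) :=
  Relation.ReflTransGen.single (.bottom h)

/-- The partition with blocks `{x, (π x)'}`. -/
def perm (π : Equiv.Perm X) : PartitionMonoid X := ⟨Setoid.ker (Sum.elim π id : X ⊕ X → X)⟩

theorem perm_rel {π : Equiv.Perm X} {a b : X ⊕ X} :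
    (perm π).rel a b ↔ Sum.elim π id a = Sum.elim π id b := Iff.rfl

/-- The blocks of `perm π` only rename upper points, so `s` retracts the product graph onto the
vertices of `β`. -/
theorem perm_mul_rel (π : Equiv.Perm X) (β : PartitionMonoid X) (a b : X ⊕ X) :
    (perm π * β).rel a b ↔ β.rel (Sum.map π id a) (Sum.map π id b) := by
  let s : ProductVertex X → X ⊕ X := fun
    | .up x => .inl (π x)
    | .mid x => .inl x
    | .low x => .inr x
  have hs : ∀ d, s (outer d) = Sum.map π id d := by rintro (x | x) <;> rfl
  have hs' : ∀ d, s (placeBottom d) = d := by rintro (x | x) <;> rfl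
  have hs'' : ∀ d, s (placeTop d) = .inl (Sum.elim π id d) := by rintro (x | x) <;> rfl
  have hb : ∀ d, productConn (perm π) β (outer d) (placeBottom (Sum.map π id d)) := by
    rintro (x | x)
    · exact conn_top (α := perm π) β (a := .inl x) (b := .inr (π x)) rfl
    · exact .refl
  constructor
  · intro h
    rw [← hs, ← hs]
    refine mul_rel_induction (fun w => β.rel (s (outer a)) (s w)) ?_ ?_ h (β.rel.refl _)
    · intro c d hcd hc
      rw [hs''] at hc ⊢
      rwa [← perm_rel.1 hcd]
    · intro c d hcd hc
      rw [hs'] at hc ⊢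
      exact β.rel.trans hc hcd
  · intro h
    exact ((productConn _ _).trans (hb a) ((productConn _ _).trans (conn_bottom _ h)
      ((productConn _ _).symm (hb b))))

theorem perm_mul_perm (π σ : Equiv.Perm X) : perm π * perm σ = perm (π.trans σ) := by
  refine PartitionMonoid.ext (Setoid.ext fun a b => ?_)
  rw [perm_mul_rel, perm_rel, perm_rel]
  rcases a with a | a <;> rcases b with b | b <;> rfl

theorem perm_refl : perm (Equiv.refl X) = 1 :=
  PartitionMonoid.ext (Setoid.ext fun _ _ => Iff.rfl)

theorem perm_mem_units (π : Equiv.Perm X) : perm π ∈ units X :=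
  isUnit_iff_exists.2 ⟨perm π.symm,
    by rw [perm_mul_perm, Equiv.self_trans_symm, perm_refl],
    by rw [perm_mul_perm, Equiv.symm_trans_self, perm_refl]⟩

/-- The involution interchanging the two rows. -/
def star (α : PartitionMonoid X) : PartitionMonoid X := ⟨α.rel.comap Sum.swap⟩

theorem star_rel {α : PartitionMonoid X} {a b : X ⊕ X} :
    α.star.rel a b ↔ α.rel a.swap b.swap := Iff.rfl

@[simp] theorem star_star (α : PartitionMonoid X) : α.star.star = α :=
  PartitionMonoid.ext (Setoid.ext fun a b => by simp [star_rel])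

theorem star_mul_rel_of {α β : PartitionMonoid X} {a b : X ⊕ X} (h : (α * β).rel a.swap b.swap) :
    (β.star * α.star).rel a b := by
  let s : ProductVertex X → ProductVertex X := fun
    | .up x => .low x
    | .mid x => .mid x
    | .low x => .up x
  have hs : ∀ d : X ⊕ X, s (outer d.swap) = outer d := by rintro (x | x) <;> rfl
  have hst : ∀ d : X ⊕ X, s (placeTop d) = placeBottom d.swap := by rintro (x | x) <;> rfl
  have hsb : ∀ d : X ⊕ X, s (placeBottom d) = placeTop d.swap := by rintro (x | x) <;> rfl
  change productConn _ _ _ _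
  rw [← hs a, ← hs b]
  refine mul_rel_induction (fun w => productConn β.star α.star (s (outer a.swap)) (s w))
    ?_ ?_ h ((productConn _ _).refl _)
  · intro c d hcd hc
    rw [hst] at hc ⊢
    exact (productConn _ _).trans hc (conn_bottom _ (by simpa [star_rel] using hcd))
  · intro c d hcd hc
    rw [hsb] at hc ⊢
    exact (productConn _ _).trans hc (conn_top _ (by simpa [star_rel] using hcd))

theorem star_mul (α β : PartitionMonoid X) : (α * β).star = β.star * α.star := by
  refine PartitionMonoid.ext (Setoid.ext fun a b => ⟨star_mul_rel_of, fun h => ?_⟩)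
  have := star_mul_rel_of (α := β.star) (β := α.star) (a := a.swap) (b := b.swap)
    (by simpa using h)
  rwa [star_star, star_star] at this

theorem star_one : (1 : PartitionMonoid X).star = 1 := by
  refine PartitionMonoid.ext (Setoid.ext fun a b => ?_)
  rw [star_rel, one_rel, one_rel]
  rcases a with a | a <;> rcases b with b | b <;> rfl

theorem star_mem_units {α : PartitionMonoid X} (h : α ∈ units X) : α.star ∈ units X := by
  obtain ⟨β, h1, h2⟩ := isUnit_iff_exists.1 h
  refine isUnit_iff_exists.2 ⟨β.star, ?_, ?_⟩
  · rw [← star_mul, h2, star_one]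
  · rw [← star_mul, h1, star_one]

theorem star_mem_leftSet {α : PartitionMonoid X} : α.star ∈ leftSet X ↔ α ∈ rightSet X := Iff.rfl

theorem star_mem_rightSet {α : PartitionMonoid X} : α.star ∈ rightSet X ↔ α ∈ leftSet X := Iff.rfl

/-- The involution swaps `L_X` with `R_X` and the starred parameters with the unstarred ones, so
one-sided arguments need to be made only once. -/
theorem closure_star {α β : PartitionMonoid X}
    (h : Subsemigroup.closure (units X ∪ {α, β}) = ⊤) :
    Subsemigroup.closure (units X ∪ {β.star, α.star}) = ⊤ := by
  refine eq_top_iff.2 fun γ _ => ?_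
  have hγ : γ.star ∈ Subsemigroup.closure (units X ∪ {α, β}) := h ▸ Subsemigroup.mem_top _
  suffices hs : ∀ δ ∈ Subsemigroup.closure (units X ∪ {α, β}),
      δ.star ∈ Subsemigroup.closure (units X ∪ {β.star, α.star}) by
    simpa using hs _ hγ
  intro δ hδ
  induction hδ using Subsemigroup.closure_induction with
  | mem δ hδ =>
    refine Subsemigroup.subset_closure ?_
    rcases hδ with hδ | rfl | rfl
    · exact .inl (star_mem_units hδ)
    · exact .inr (.inr rfl)
    · exact .inr (.inl rfl)
  | mul δ ε _ _ h1 h2 => rw [star_mul]; exact mul_mem h2 h1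

/-! ### The submonoids of left and right type -/

theorem mem_rightSet_iff {δ : PartitionMonoid X} :
    δ ∈ rightSet X ↔ (∀ y, ∃ x, δ.rel (.inr y) (.inl x)) ∧
      ∀ y z, δ.rel (.inr y) (.inr z) → y = z := by
  refine and_congr eq_univ_iff_forall ⟨fun h y z hyz => ?_, fun h => ?_⟩
  · have : δ.coker y z := hyz
    rwa [h] at this
  · exact Setoid.ext fun y z => ⟨fun hyz => h y z hyz, fun hyz => by
      have : y = z := hyz
      rw [this]⟩

theorem mem_leftSet_iff {γ : PartitionMonoid X} :
    γ ∈ leftSet X ↔ (∀ y, ∃ x, γ.rel (.inl y) (.inr x)) ∧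
      ∀ y z, γ.rel (.inl y) (.inl z) → y = z := by
  rw [← star_mem_rightSet, mem_rightSet_iff]; rfl

/-- Relations of `δ` within the lower row persist in the product, and a block of `δ` inside `X'`
cannot be left by any path. -/
theorem mem_rightSet_of_mul {γ δ : PartitionMonoid X} (h : γ * δ ∈ rightSet X) :
    δ ∈ rightSet X := by
  rw [mem_rightSet_iff] at h ⊢
  refine ⟨fun y => ?_, fun y z hyz => h.2 y z (conn_bottom (a := .inr y) (b := .inr z) _ hyz)⟩
  by_contra! hcon
  obtain ⟨x, hx⟩ := h.1 y
  refine mul_rel_induction (fun v => ∃ z, v = .low z ∧ δ.rel (.inr y) (.inr z)) ?_ ?_ hx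
    ⟨y, rfl, δ.rel.refl _⟩ |>.elim fun z hz => by cases hz.1
  · rintro (a | a) b - ⟨z, hz, -⟩ <;> cases hz
  · rintro (a | a) b hab ⟨z, hz, hyz⟩
    · cases hz
    · cases hz
      rcases b with b | b
      · exact absurd (δ.rel.trans hyz hab) (hcon b)
      · exact ⟨b, rfl, δ.rel.trans hyz hab⟩

theorem mem_leftSet_of_mul {γ δ : PartitionMonoid X} (h : γ * δ ∈ leftSet X) : γ ∈ leftSet X := by
  rw [← star_mem_rightSet, star_mul] at h
  exact star_mem_rightSet.1 (mem_rightSet_of_mul h)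

theorem one_mem_rightSet : (1 : PartitionMonoid X) ∈ rightSet X :=
  mem_rightSet_iff.2 ⟨fun y => ⟨y, rfl⟩, fun _ _ h => h⟩

theorem units_subset_rightSet : units X ⊆ rightSet X := by
  intro α h
  obtain ⟨β, -, h2⟩ := isUnit_iff_exists.1 h
  exact mem_rightSet_of_mul (h2 ▸ one_mem_rightSet)

theorem units_subset_leftSet : units X ⊆ leftSet X := fun _ h =>
  star_mem_rightSet.1 (units_subset_rightSet (star_mem_units h))

theorem mul_mem_rightSet {γ δ : PartitionMonoid X} (hγ : γ ∈ rightSet X) (hδ : δ ∈ rightSet X) :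
    γ * δ ∈ rightSet X := by
  rw [mem_rightSet_iff] at *
  refine ⟨fun y => ?_, fun y z hyz => ?_⟩
  · obtain ⟨m, hm⟩ := hδ.1 y
    obtain ⟨x, hx⟩ := hγ.1 m
    exact ⟨x, (productConn γ δ).trans (conn_bottom γ hm) (conn_top δ hx)⟩
  -- The component of `y'` consists of the block of `δ` at `y'` and the blocks of `γ` attached to
  -- its upper points; the trivial cokernel of `γ` prevents it from spreading further.
  · refine (mul_rel_induction (fun
      | .up u => ∃ m, γ.rel (.inl u) (.inr m) ∧ δ.rel (.inl m) (.inr y)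
      | .mid m => δ.rel (.inl m) (.inr y)
      | .low z => z = y) ?_ ?_ hyz rfl : z = y).symm
    · rintro (a | a) (b | b) hab ha
      · exact ⟨ha.choose, γ.rel.trans (γ.rel.symm hab) ha.choose_spec.1, ha.choose_spec.2⟩
      · obtain ⟨m, hm, hmy⟩ := ha
        have : b = m := hγ.2 _ _ (γ.rel.trans (γ.rel.symm hab) hm)
        exact this ▸ hmy
      · exact ⟨a, γ.rel.symm hab, ha⟩
      · exact hγ.2 _ _ hab ▸ ha
    · rintro (a | a) (b | b) hab ha
      · exact δ.rel.trans (δ.rel.symm hab) ha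
      · exact hδ.2 _ _ (δ.rel.trans (δ.rel.symm hab) ha)
      · cases ha; exact δ.rel.symm hab
      · cases ha; exact (hδ.2 _ _ hab).symm

theorem mul_mem_leftSet {γ δ : PartitionMonoid X} (hγ : γ ∈ leftSet X) (hδ : δ ∈ leftSet X) :
    γ * δ ∈ leftSet X := by
  rw [← star_mem_rightSet, star_mul]
  exact mul_mem_rightSet (star_mem_rightSet.2 hδ) (star_mem_rightSet.2 hγ)

theorem exists_perm_eq {α : PartitionMonoid X} (hl : α ∈ leftSet X) (hr : α ∈ rightSet X) :
    ∃ π, α = perm π := by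
  rw [mem_leftSet_iff] at hl
  rw [mem_rightSet_iff] at hr
  choose p hp using hl.1
  have hinj : Function.Injective p := fun x y hxy =>
    hl.2 _ _ (α.rel.trans (hp x) (hxy ▸ α.rel.symm (hp y)))
  have hsurj : Function.Surjective p := fun y => by
    obtain ⟨x, hx⟩ := hr.1 y
    exact ⟨x, hr.2 _ _ (α.rel.symm (α.rel.trans hx (hp x)))⟩
  refine ⟨Equiv.ofBijective p ⟨hinj, hsurj⟩, PartitionMonoid.ext (Setoid.ext fun a b => ?_)⟩
  have key : ∀ a, α.rel a (.inr (Sum.elim p id a)) := by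
    rintro (x | x)
    · exact hp x
    · exact α.rel.refl _
  have : (perm (Equiv.ofBijective p ⟨hinj, hsurj⟩)).rel a b ↔
      Sum.elim p id a = Sum.elim p id b := Iff.rfl
  rw [this]
  refine ⟨fun h => hr.2 _ _ (α.rel.trans (α.rel.symm (key a)) (α.rel.trans h (key b))), fun h => ?_⟩
  exact α.rel.trans (key a) (h ▸ α.rel.symm (key b))

theorem mem_units_iff {α : PartitionMonoid X} :
    α ∈ units X ↔ α ∈ leftSet X ∧ α ∈ rightSet X := by
  refine ⟨fun h => ⟨units_subset_leftSet h, units_subset_rightSet h⟩, fun h => ?_⟩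
  obtain ⟨π, rfl⟩ := exists_perm_eq h.1 h.2
  exact perm_mem_units π

/-! ### The cardinal parameters -/

/-- Replaces blocks by points of the quotient, so that the cardinal parameters count fibres of the
quotient map. -/
theorem mk_blocks_eq (α : PartitionMonoid X) (P : Set (X ⊕ X) → Prop) :
    #{A // A ∈ α.blocks ∧ P A} = #{w : Quotient α.rel // P {a | Quotient.mk α.rel a = w}} := by
  have hmem : ∀ w : Quotient α.rel, {a | Quotient.mk α.rel a = w} ∈ α.blocks := by
    rintro ⟨a⟩
    exact ⟨a, Set.ext fun b => Quotient.eq⟩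
  refine (mk_congr (Equiv.ofBijective
    (fun w : {w : Quotient α.rel // P {a | Quotient.mk α.rel a = w}} =>
      (⟨{a | Quotient.mk α.rel a = w.1}, hmem w.1, w.2⟩ : {A // A ∈ α.blocks ∧ P A}))
    ⟨?_, ?_⟩)).symm
  · rintro ⟨⟨a⟩, ha⟩ ⟨w, hw⟩ h
    have h' : {b | Quotient.mk α.rel b = Quotient.mk α.rel a} = {b | Quotient.mk α.rel b = w} :=
      congrArg Subtype.val h
    exact Subtype.ext ((Set.ext_iff.1 h' a).1 rfl)
  · rintro ⟨A, ⟨a, rfl⟩, hA⟩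
    have h : {b | Quotient.mk α.rel b = Quotient.mk α.rel a} = {b | α.rel b a} :=
      Set.ext fun b => Quotient.eq
    exact ⟨⟨Quotient.mk α.rel a, by rwa [h]⟩, Subtype.ext h⟩

theorem d_eq (α : PartitionMonoid X) (μ : Cardinal.{u}) :
    α.d μ = #{w : Quotient α.rel | (∀ y, Quotient.mk α.rel (.inr y) ≠ w) ∧
      μ ≤ #{x // Quotient.mk α.rel (.inl x) = w}} := by
  refine (mk_congr (Equiv.subtypeEquivRight fun A => and_assoc)).trans
    ((mk_blocks_eq α _).trans (mk_congr (Equiv.subtypeEquivRight fun w => ?_)))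
  exact and_congr eq_empty_iff_forall_notMem Iff.rfl

theorem dStar_eq (α : PartitionMonoid X) (μ : Cardinal.{u}) :
    α.dStar μ = #{w : Quotient α.rel | (∀ y, Quotient.mk α.rel (.inl y) ≠ w) ∧
      μ ≤ #{x // Quotient.mk α.rel (.inr x) = w}} := by
  refine (mk_congr (Equiv.subtypeEquivRight fun A => and_assoc)).trans
    ((mk_blocks_eq α _).trans (mk_congr (Equiv.subtypeEquivRight fun w => ?_)))
  exact and_congr eq_empty_iff_forall_notMem Iff.rfl

theorem k_eq (α : PartitionMonoid X) (μ : Cardinal.{u}) :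
    α.k μ = #{w : Quotient α.rel | ((∃ x, Quotient.mk α.rel (.inl x) = w) ∧
      ∃ y, Quotient.mk α.rel (.inr y) = w) ∧ μ ≤ #{x // Quotient.mk α.rel (.inl x) = w}} := by
  refine (mk_congr (Equiv.subtypeEquivRight fun A => and_assoc)).trans
    ((mk_blocks_eq α _).trans (mk_congr (Equiv.subtypeEquivRight fun w => ?_)))
  exact Iff.rfl

theorem mk_blocks_star (α : PartitionMonoid X) (P Q : Set (X ⊕ X) → Prop)
    (h : ∀ A, P A ↔ Q (Sum.swap ⁻¹' A)) :
    #{A // A ∈ α.blocks ∧ P A} = #{A // A ∈ α.star.blocks ∧ Q A} := by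
  have hinv : Function.Involutive (fun A : Set (X ⊕ X) => Sum.swap ⁻¹' A) := fun A => by
    ext (x | x) <;> rfl
  have hsub : ∀ (β : PartitionMonoid X) (A : Set (X ⊕ X)), A ∈ β.blocks →
      Sum.swap ⁻¹' A ∈ β.star.blocks := by
    rintro β _ ⟨a, rfl⟩
    exact ⟨a.swap, Set.ext fun b => by simp [star_rel]⟩
  refine mk_congr (hinv.toPerm.subtypeEquiv fun A => and_congr ⟨hsub α A, fun hA => ?_⟩ (h A))
  have h' : Sum.swap ⁻¹' (Sum.swap ⁻¹' A) ∈ α.star.star.blocks := hsub _ _ hA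
  rwa [star_star, show Sum.swap ⁻¹' (Sum.swap ⁻¹' A) = A from hinv A] at h'

theorem dStar_star (α : PartitionMonoid X) (μ : Cardinal.{u}) : α.star.dStar μ = α.d μ :=
  ((mk_congr (Equiv.subtypeEquivRight fun _ => and_assoc)).trans
    ((mk_blocks_star α _ _ fun _ => Iff.rfl).trans
      (mk_congr (Equiv.subtypeEquivRight fun _ => and_assoc.symm)))).symm

theorem kStar_star (α : PartitionMonoid X) (μ : Cardinal.{u}) : α.star.kStar μ = α.k μ :=
  ((mk_congr (Equiv.subtypeEquivRight fun _ => and_assoc)).trans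
    ((mk_blocks_star α _
      (fun A => ((upperPart A).Nonempty ∧ (lowerPart A).Nonempty) ∧ μ ≤ #(lowerPart A))
      fun _ => and_congr and_comm Iff.rfl).trans
      (mk_congr (Equiv.subtypeEquivRight fun _ => and_assoc.symm)))).symm

theorem d_star (α : PartitionMonoid X) (μ : Cardinal.{u}) : α.star.d μ = α.dStar μ := by
  rw [← dStar_star, star_star]

theorem k_star (α : PartitionMonoid X) (μ : Cardinal.{u}) : α.star.k μ = α.kStar μ := by
  rw [← kStar_star, star_star]

theorem mk_quotient_le_of_infinite (hX : ℵ₀ ≤ #X) (α : PartitionMonoid X) :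
    #(Quotient α.rel) ≤ #X :=
  mk_quotient_le.trans (by rw [mk_sum, lift_id, add_eq_self hX])

theorem d_le (hX : ℵ₀ ≤ #X) (α : PartitionMonoid X) (μ : Cardinal.{u}) : α.d μ ≤ #X := by
  rw [d_eq]; exact (mk_set_le _).trans (mk_quotient_le_of_infinite hX α)

theorem k_le (hX : ℵ₀ ≤ #X) (α : PartitionMonoid X) (μ : Cardinal.{u}) : α.k μ ≤ #X := by
  rw [k_eq]; exact (mk_set_le _).trans (mk_quotient_le_of_infinite hX α)

theorem d_anti (α : PartitionMonoid X) {μ ν : Cardinal.{u}} (h : μ ≤ ν) : α.d ν ≤ α.d μ :=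
  mk_subtype_mono fun _ hA => ⟨hA.1, h.trans hA.2⟩

theorem k_anti (α : PartitionMonoid X) {μ ν : Cardinal.{u}} (h : μ ≤ ν) : α.k ν ≤ α.k μ :=
  mk_subtype_mono fun _ hA => ⟨hA.1, h.trans hA.2⟩

/-! ### Sufficiency -/

/-- The permutation sends the lower points of large transversals of the first `β` to points of
distinct upper nontransversals of the second. The glued components no longer reach the lower row,
and they keep their large upper parts. -/
theorem exists_le_d_mul (hX : ℵ₀ ≤ #X) {β : PartitionMonoid X} (hβ : β ∈ rightSet X)
    (hd : #X ≤ β.d 1) {I : Type u} (hI : #I ≤ #X) (m : I → Cardinal.{u})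
    (hk : ∀ i, #X ≤ β.k (m i)) :
    ∃ π, ∀ i, #X ≤ (β * (perm π * β)).d (m i) := by
  rcases isEmpty_or_nonempty I with hIe | ⟨⟨i₀⟩⟩
  · exact ⟨Equiv.refl X, fun i => hIe.elim i⟩
  rw [mem_rightSet_iff] at hβ
  -- Only the `inl` half will be glued; the `inr` half leaves both ranges with complements of size
  -- `#X`, so the partial matching extends to a permutation.
  have hT : #((X ⊕ X) × I) ≤ #X := by
    rw [mk_prod, lift_id, lift_id, mk_sum, lift_id, add_eq_self hX]
    exact (mul_le_mul' le_rfl hI).trans (mul_eq_self hX).le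
  obtain ⟨p, hpinj, hp⟩ := exists_injective_choice hT
    (fun t => {w : Quotient β.rel | ((∃ x, Quotient.mk β.rel (.inl x) = w) ∧
      ∃ y, Quotient.mk β.rel (.inr y) = w) ∧ m t.2 ≤ #{x // Quotient.mk β.rel (.inl x) = w}})
    (fun t => by rw [← k_eq]; exact hk t.2)
  choose u hu using fun t => (hp t).1.1
  choose y hy using fun t => (hp t).1.2
  have hyinj : Function.Injective y := fun s t h => hpinj (by rw [← hy, h, hy])
  rw [d_eq] at hd
  obtain ⟨j⟩ := hT.trans hd
  have hq : ∀ t, ∃ x, Quotient.mk β.rel (.inl x) = (j t).1 := by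
    intro t
    obtain ⟨⟨a⟩, ha⟩ := j t
    rcases a with x | z
    · exact ⟨x, rfl⟩
    · exact absurd rfl (ha.1 z)
  choose q hq using hq
  have hqinj : ∀ s t, β.rel (.inl (q s)) (.inl (q t)) → s = t := fun s t h =>
    j.injective (Subtype.ext (by rw [← hq, ← hq]; exact Quotient.eq.2 h))
  have hqjunk : ∀ t z, ¬ β.rel (.inl (q t)) (.inr z) := fun t z h =>
    (j t).2.1 z (by rw [← hq]; exact Quotient.eq.2 (β.rel.symm h))
  have hqinj' : Function.Injective q := fun s t h => hqinj s t (h ▸ β.rel.refl _)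
  let ι : X × I → (X ⊕ X) × I := fun z => (.inl z.1, z.2)
  have hι : Function.Injective ι := fun a b h => by
    simp only [ι, Prod.mk.injEq, Sum.inl.injEq] at h
    exact Prod.ext h.1 h.2
  have hcompl : ∀ g : (X ⊕ X) × I → X, Function.Injective g →
      #↥(range (g ∘ ι))ᶜ = #X := fun g hg => by
    refine le_antisymm (mk_set_le _) ?_
    have h1 : #(range fun x : X => g (.inr x, i₀)) = #X :=
      mk_range_eq _ fun a b h => by simpa using hg h
    refine h1.symm.le.trans (mk_le_mk_of_subset ?_)
    rintro _ ⟨x, rfl⟩ ⟨z, hz⟩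
    exact absurd (hg hz) (by simp [ι])
  obtain ⟨π, hπ⟩ := exists_equiv_extending (hyinj.comp hι) (hqinj'.comp hι)
    ((hcompl y hyinj).trans (hcompl q hqinj').symm)
  refine ⟨π, fun i => ?_⟩
  -- the component of the `t`-th glued block
  have hcomp : ∀ z w, productConn β (perm π * β) (.up (u (ι z))) w → (match w with
      | .up a => ∃ b, β.rel (.inl a) (.inr b) ∧ β.rel (.inl (π b)) (.inl (q (ι z)))
      | .mid b => β.rel (.inl (π b)) (.inl (q (ι z)))
      | .low _ => False) := by
    intro z w hw
    refine mul_rel_induction (fun w => match w with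
      | .up a => ∃ b, β.rel (.inl a) (.inr b) ∧ β.rel (.inl (π b)) (.inl (q (ι z)))
      | .mid b => β.rel (.inl (π b)) (.inl (q (ι z)))
      | .low _ => False) ?_ ?_ hw
      ⟨y (ι z), Quotient.eq.1 ((hu _).trans (hy _).symm), ?_⟩
    · rintro (a | a) (b | b) hab ha
      · exact ⟨ha.choose, β.rel.trans (β.rel.symm hab) ha.choose_spec.1, ha.choose_spec.2⟩
      · obtain ⟨c, hc, hcz⟩ := ha
        have : b = c := hβ.2 _ _ (β.rel.trans (β.rel.symm hab) hc)
        exact this ▸ hcz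
      · exact ⟨a, β.rel.symm hab, ha⟩
      · exact hβ.2 _ _ hab ▸ ha
    · rintro (a | a) (b | b) hab ha
      · rw [perm_mul_rel] at hab
        exact β.rel.trans (β.rel.symm hab) ha
      · rw [perm_mul_rel] at hab
        exact hqjunk _ _ (β.rel.trans (β.rel.symm ha) hab)
      · exact (ha : False).elim
      · exact (ha : False).elim
    · rw [show π (y (ι z)) = q (ι z) from hπ z]
  rw [d_eq]
  refine mk_le_of_injective
    (f := fun x => ⟨Quotient.mk _ (.inl (u (ι (x, i)))), fun z hz => ?_, ?_⟩) ?_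
  · have hz' : (β * (perm π * β)).rel (.inr z) (.inl (u (ι (x, i)))) := Quotient.eq.1 hz
    exact hcomp (x, i) (.low z) ((productConn _ _).symm hz')
  · refine (hp (ι (x, i))).2.trans (mk_le_of_injective (f := fun a => ⟨a.1, Quotient.eq.2 ?_⟩)
      fun a b h => Subtype.ext (congrArg (fun c => c.1) h))
    exact conn_top (a := .inl a.1) (b := .inl (u (ι (x, i)))) _
      (Quotient.eq.1 (a.2.trans (hu _).symm))
  · intro x x' h
    have h' : (β * (perm π * β)).rel (.inl (u (ι (x, i)))) (.inl (u (ι (x', i)))) :=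
      Quotient.eq.1 (congrArg Subtype.val h)
    obtain ⟨b, hb, hb'⟩ := hcomp (x, i) (.up (u (ι (x', i)))) h'
    -- By triviality of the cokernel, a transversal of `β` has only one lower point.
    have hb₂ : b = y (ι (x', i)) :=
      hβ.2 _ _ (Quotient.eq.1 (((Quotient.eq.2 hb).symm.trans (hu _)).trans (hy _).symm))
    rw [hb₂, show π (y (ι (x', i))) = q (ι (x', i)) from hπ _] at hb'
    have := hι (hqinj _ _ hb')
    simpa using this.symm

/-- Blocks of `α` and `β` are coloured by blocks of `γ`, and `σ` is chosen so that the components of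
the product graph are exactly the colour classes. -/
theorem exists_eq_mul (hX : (#X).IsSingular) {α β : PartitionMonoid X} (hα : α ∈ leftSet X)
    (hβ : β ∈ rightSet X) (ha : #X ≤ α.dStar 2) (hb : ∀ μ < #X, #X ≤ β.d μ)
    (γ : PartitionMonoid X) : ∃ σ, γ = α * (perm σ * β) := by
  rw [mem_leftSet_iff] at hα
  rw [mem_rightSet_iff] at hβ
  have hinf := hX.aleph0_le
  obtain ⟨I, m, hI, hm, hcof⟩ := hX.exists_cofinal_family
  have hne : Nonempty X := mk_ne_zero_iff.1 (aleph0_pos.trans_le hinf).ne'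
  have : Nonempty (Quotient γ.rel) := hne.map fun x => Quotient.mk _ (.inl x)
  let iα : X → Quotient α.rel := fun x => Quotient.mk _ (.inl x)
  let hα' : X → Quotient α.rel := fun x => Quotient.mk _ (.inr x)
  let iβ : X → Quotient β.rel := fun x => Quotient.mk _ (.inr x)
  let fβ : X → Quotient β.rel := fun x => Quotient.mk _ (.inl x)
  have hiα : Function.Injective iα := fun x y h => hα.2 _ _ (Quotient.eq.1 h)
  have hiβ : Function.Injective iβ := fun x y h => hβ.2 _ _ (Quotient.eq.1 h)
  have hsα : Function.Surjective hα' := by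
    rintro ⟨x | x⟩
    · obtain ⟨y, hy⟩ := hα.1 x
      exact ⟨y, Quotient.eq.2 (α.rel.symm hy)⟩
    · exact ⟨x, rfl⟩
  have hsβ : Function.Surjective fβ := by
    rintro ⟨x | x⟩
    · exact ⟨x, rfl⟩
    · obtain ⟨y, hy⟩ := hβ.1 x
      exact ⟨y, Quotient.eq.2 (β.rel.symm hy)⟩
  -- On the side of `α` the only threshold is 2, so one large set suffices; on the side of `β` there
  -- is one for each member of the cofinal family.
  obtain ⟨cV, hcV, hcV'⟩ := exists_coloring hinf (mk_quotient_le_of_infinite hinf γ)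
    (I := PUnit) (by rw [mk_punit]; exact (one_lt_aleph0.trans_le hinf).le) hiα
    (fun x => Quotient.mk γ.rel (.inl x))
    (fun _ => {w | (∀ x, iα x ≠ w) ∧ 2 ≤ #{x // hα' x = w}})
    (fun _ x h => h.1 x rfl) (fun _ => by rw [dStar_eq] at ha; exact ha)
  obtain ⟨cW, hcW, hcW'⟩ := exists_coloring hinf (mk_quotient_le_of_infinite hinf γ)
    hI.le hiβ (fun x => Quotient.mk γ.rel (.inr x))
    (fun i => {w | (∀ x, iβ x ≠ w) ∧ m i ≤ #{x // fβ x = w}})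
    (fun _ x h => h.1 x rfl) (fun i => by have := hb _ (hm i); rw [d_eq] at this; exact this)
  obtain ⟨σ, hσ, hconn⟩ := exists_connected_colored_matching hX hsα hsβ cV cW
    (fun a => (hcV' ⟨⟩ a).trans (mk_le_mk_of_subset fun w hw => ⟨by
      obtain ⟨e, e', hne⟩ := two_le_iff.1 hw.1.2
      exact ⟨e, e', fun h => hne (Subtype.ext h), e.2, e'.2⟩, hw.2⟩))
    (fun μ hμ a => by
      obtain ⟨i, hi⟩ := hcof μ hμ
      exact (hcW' i a).trans (mk_le_mk_of_subset fun w hw => ⟨hi.trans hw.1.2, hw.2⟩))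
  refine ⟨σ, PartitionMonoid.ext (Setoid.ext fun a b => ?_)⟩
  constructor
  · intro hab
    let Y := Quotient (productConn α (perm σ * β))
    let φ : Quotient α.rel → Y := Quotient.map placeTop fun _ _ h => conn_top _ h
    let ψ : Quotient β.rel → Y := Quotient.map (fun a => placeBottom (Sum.map σ.symm id a))
      fun c d h => conn_bottom _ (by
        rw [perm_mul_rel]
        simpa using h)
    have hφψ := hconn φ ψ fun e => by
      change Quotient.mk _ (ProductVertex.mid e) = Quotient.mk _ (ProductVertex.mid (σ.symm (σ e)))
      rw [σ.symm_apply_apply]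
    have hout : ∀ c, (∃ v, φ v = Quotient.mk _ (outer c) ∧ cV v = Quotient.mk γ.rel c) ∨
        ∃ w, ψ w = Quotient.mk _ (outer c) ∧ cW w = Quotient.mk γ.rel c := by
      rintro (x | x)
      · exact .inl ⟨iα x, rfl, hcV x⟩
      · exact .inr ⟨iβ x, rfl, hcW x⟩
    have hab' : Quotient.mk γ.rel a = Quotient.mk γ.rel b := Quotient.eq.2 hab
    suffices h : Quotient.mk (productConn α (perm σ * β)) (outer a) = Quotient.mk _ (outer b) from
      (Quotient.eq.1 h : productConn _ _ _ _)
    have hposV : ∀ a, ∃ v, cV v = a := fun a => by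
      obtain ⟨v⟩ := mk_ne_zero_iff.1 ((aleph0_pos.trans_le hinf).trans_le (hcV' ⟨⟩ a)).ne'
      exact ⟨v.1, v.2.2⟩
    have hpos : ∀ a, ∃ w, cW w = a := fun a => by
      obtain ⟨i, -⟩ := hcof 0 (aleph0_pos.trans_le hinf)
      obtain ⟨v⟩ := mk_ne_zero_iff.1 ((aleph0_pos.trans_le hinf).trans_le (hcW' i a)).ne'
      exact ⟨v.1, v.2.2⟩
    -- `hφψ` compares a block of `α` with a block of `β`, so two points of the same row are compared
    -- through a block of the same colour in the other factor.
    rcases hout a with ⟨v, hv, hva⟩ | ⟨v, hv, hva⟩ <;>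
      rcases hout b with ⟨w, hw, hwb⟩ | ⟨w, hw, hwb⟩ <;> rw [← hv, ← hw]
    · obtain ⟨r, hr⟩ := hpos (Quotient.mk γ.rel b)
      rw [hφψ v r (by rw [hva, hr, hab']), hφψ w r (by rw [hwb, hr])]
    · exact hφψ v w (by rw [hva, hwb, hab'])
    · exact (hφψ w v (by rw [hva, hwb, hab'])).symm
    · obtain ⟨r, hr⟩ := hposV (Quotient.mk γ.rel b)
      rw [← hφψ r v (by rw [hva, hr, hab']), ← hφψ r w (by rw [hwb, hr])]
  · intro hab
    -- The colour of a vertex is constant along edges, so no path joins different blocks of `γ`.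
    let g : ProductVertex X → Quotient γ.rel := fun
      | .up x => Quotient.mk _ (.inl x)
      | .mid x => cV (hα' x)
      | .low x => Quotient.mk _ (.inr x)
    have hg : ∀ c, g (outer c) = Quotient.mk _ c := by rintro (x | x) <;> rfl
    have hgt : ∀ c, g (placeTop c) = cV (Quotient.mk _ c) := by
      rintro (x | x)
      · exact (hcV x).symm
      · rfl
    have hgb : ∀ c, g (placeBottom c) = cW (Quotient.mk _ (Sum.map σ id c)) := by
      rintro (x | x)
      · exact (hσ x).symm
      · exact (hcW x).symm
    have h1 : g (outer b) = g (outer a) := by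
      refine mul_rel_induction (fun w => g w = g (outer a)) ?_ ?_ hab rfl
      · intro c d hcd hc
        rw [← hc, hgt, hgt, Quotient.eq.2 hcd]
      · intro c d hcd hc
        rw [perm_mul_rel] at hcd
        rw [← hc, hgb, hgb, Quotient.eq.2 hcd]
    rw [hg, hg] at h1
    exact γ.rel.symm (Quotient.eq.1 h1)

/-- Either large transversals abound at all thresholds, and they are converted by `exists_le_d_mul`,
or they are few at some `m i₀`. In the second case `β` itself works: above `m i₀` transversals
remain few, so nontransversals must abound, and below it `d` can only increase. -/
theorem exists_mem_le_d (hX : ℵ₀ ≤ #X) {S : Subsemigroup (PartitionMonoid X)}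
    (hS : units X ⊆ S) {β : PartitionMonoid X} (hβS : β ∈ S) (hβ : β ∈ rightSet X)
    (hd : β.d 1 = #X) {I : Type u} (hI : #I ≤ #X) (m : I → Cardinal.{u})
    (h : ∀ i, β.k (m i) + β.d (m i) = #X) :
    ∃ β' ∈ S, β' ∈ rightSet X ∧ ∀ i, #X ≤ β'.d (m i) := by
  have hor : ∀ i, β.k (m i) < #X → #X ≤ β.d (m i) := fun i hi => by
    by_contra! hlt
    exact absurd (h i) (add_lt_of_lt hX hi hlt).ne
  by_cases hk : ∀ i, #X ≤ β.k (m i)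
  · obtain ⟨π, hπ⟩ := exists_le_d_mul hX hβ hd.ge hI m hk
    exact ⟨_, mul_mem hβS (mul_mem (hS (perm_mem_units π)) hβS), mul_mem_rightSet hβ
      (mul_mem_rightSet (units_subset_rightSet (perm_mem_units π)) hβ), hπ⟩
  · push Not at hk
    obtain ⟨i₀, hi₀⟩ := hk
    refine ⟨β, hβS, hβ, fun i => ?_⟩
    rcases le_total (m i) (m i₀) with hle | hle
    · exact (hor i₀ hi₀).trans (d_anti β hle)
    · exact hor i ((k_anti β hle).trans_lt hi₀)

theorem closure_eq_top (hX : (#X).IsSingular) {α β : PartitionMonoid X} (hα : α ∈ leftSet X)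
    (hβ : β ∈ rightSet X) (hdα : α.dStar 1 = #X) (hdβ : β.d 1 = #X)
    (h2 : α.kStar 2 + α.dStar 2 = #X) (h : ∀ μ < #X, β.k μ + β.d μ = #X) :
    Subsemigroup.closure (units X ∪ {α, β}) = ⊤ := by
  have hinf := hX.aleph0_le
  refine eq_top_iff.2 fun γ _ => ?_
  set S := Subsemigroup.closure (units X ∪ {α, β})
  have hS : units X ⊆ S := subset_union_left.trans Subsemigroup.subset_closure
  have hαS : α ∈ S := Subsemigroup.subset_closure (.inr (.inl rfl))
  have hβS : β ∈ S := Subsemigroup.subset_closure (.inr (.inr rfl))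
  obtain ⟨I, m, hI, hm, hcof⟩ := hX.exists_cofinal_family
  obtain ⟨β', hβ'S, hβ', hβ'd⟩ := exists_mem_le_d hinf hS hβS hβ hdβ hI.le m fun i => h _ (hm i)
  -- The preimage of `S` under the involution, so that the lemma used for `β` also applies to
  -- `α.star`.
  let T : Subsemigroup (PartitionMonoid X) :=
    { carrier := {δ | δ.star ∈ S}
      mul_mem' := fun {δ ε} hδ hε => by
        change (δ * ε).star ∈ S
        rw [star_mul]
        exact mul_mem hε hδ }
  obtain ⟨α', hα'S, hα', hα'd⟩ := exists_mem_le_d hinf (S := T) (fun π hπ => hS (star_mem_units hπ))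
    (β := α.star) (by change α.star.star ∈ S; rwa [star_star]) (star_mem_rightSet.2 hα)
    (by rw [d_star, hdα]) (I := PUnit) (by rw [mk_punit]; exact (one_lt_aleph0.trans_le hinf).le)
    (fun _ => 2) (fun _ => by rw [k_star, d_star, h2])
  obtain ⟨σ, rfl⟩ := exists_eq_mul hX (star_mem_leftSet.2 hα') hβ'
    (by rw [dStar_star]; exact hα'd ⟨⟩)
    (fun μ hμ => by
      obtain ⟨i, hi⟩ := hcof μ hμ
      exact (hβ'd i).trans (d_anti β' hi)) γ
  exact mul_mem hα'S (mul_mem (hS (perm_mem_units σ)) hβ'S)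

/-! ### Necessity -/

theorem placeTop_injective : Function.Injective (placeTop : X ⊕ X → ProductVertex X) := by
  rintro (a | a) (b | b) h <;> cases h <;> rfl

theorem placeBottom_injective : Function.Injective (placeBottom : X ⊕ X → ProductVertex X) := by
  rintro (a | a) (b | b) h <;> cases h <;> rfl

/-- Fewer than `#X` points meet every upper nontransversal block. -/
def SmallDefect (γ : PartitionMonoid X) : Prop :=
  ∃ S : Set X, #S < #X ∧ ∀ x, (∀ y, ¬ γ.rel (.inl x) (.inr y)) → ∃ s ∈ S, γ.rel (.inl x) (.inl s)

/-- Fewer than `#X` points meet every kernel class of size at least `μ`. -/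
def SmallKer (γ : PartitionMonoid X) (μ : Cardinal.{u}) : Prop :=
  ∃ S : Set X, #S < #X ∧
    ∀ x, μ ≤ #{z // γ.rel (.inl x) (.inl z)} → ∃ s ∈ S, γ.rel (.inl x) (.inl s)

theorem SmallKer.mono {γ : PartitionMonoid X} {μ ν : Cardinal.{u}} (h : γ.SmallKer μ)
    (hμν : μ ≤ ν) : γ.SmallKer ν := by
  obtain ⟨S, hS, h⟩ := h
  exact ⟨S, hS, fun x hx => h x (hμν.trans hx)⟩

theorem exists_upper_representatives (γ : PartitionMonoid X) (W : Set (Quotient γ.rel))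
    (hW : #W < #X) : ∃ S : Set X, #S < #X ∧
      ∀ x, Quotient.mk γ.rel (.inl x) ∈ W → ∃ s ∈ S, γ.rel (.inl x) (.inl s) := by
  choose g hg using fun w : {w : W // ∃ x, Quotient.mk γ.rel (.inl x) = w.1} => w.2
  refine ⟨range g, (mk_range_le.trans (mk_subtype_le _)).trans_lt hW, fun x hx => ?_⟩
  exact ⟨g ⟨⟨_, hx⟩, x, rfl⟩, mem_range_self _, Quotient.eq.1 (hg ⟨⟨_, hx⟩, x, rfl⟩).symm⟩

/-- One upper point is chosen per vertex of `H`. Closure under products thus reduces to components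
avoiding a small exceptional set `H`. -/
theorem exists_connected_representatives (γ δ : PartitionMonoid X) (H : Set (ProductVertex X))
    (hH : #H < #X) : ∃ S : Set X, #S < #X ∧
      ∀ x, ∀ v ∈ H, productConn γ δ (.up x) v → ∃ s ∈ S, (γ * δ).rel (.inl x) (.inl s) := by
  choose g hg using fun w : {w : H // ∃ x, productConn γ δ (.up x) w.1} => w.2
  refine ⟨range g, (mk_range_le.trans (mk_subtype_le _)).trans_lt hH, fun x v hv hx => ?_⟩
  exact ⟨g ⟨⟨v, hv⟩, x, hx⟩, mem_range_self _,
    (productConn _ _).trans hx ((productConn _ _).symm (hg ⟨⟨v, hv⟩, x, hx⟩))⟩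

theorem smallDefect_of_d_lt {γ : PartitionMonoid X} (h : γ.d 1 < #X) : γ.SmallDefect := by
  rw [d_eq] at h
  obtain ⟨S, hS, hS'⟩ := γ.exists_upper_representatives _ h
  refine ⟨S, hS, fun x hx => hS' x ⟨fun y hy => hx y (Quotient.eq.1 hy.symm), ?_⟩⟩
  exact (mk_singleton x).ge.trans (mk_le_mk_of_subset
    (t := {z | Quotient.mk γ.rel (.inl z) = Quotient.mk γ.rel (.inl x)}) (singleton_subset_iff.2 rfl))

theorem smallDefect_of_mem_leftSet [Nonempty X] {γ : PartitionMonoid X} (h : γ ∈ leftSet X) :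
    γ.SmallDefect := by
  rw [mem_leftSet_iff] at h
  refine ⟨∅, by rw [mk_eq_zero]; exact pos_iff_ne_zero.2 (mk_ne_zero X), fun x hx => ?_⟩
  obtain ⟨y, hy⟩ := h.1 x
  exact absurd hy (hx y)

theorem smallKer_of_lt {γ : PartitionMonoid X} {μ : Cardinal.{u}}
    (h : γ.k μ + γ.d μ < #X) : γ.SmallKer μ := by
  rw [k_eq, d_eq] at h
  obtain ⟨S, hS, hS'⟩ := γ.exists_upper_representatives _ ((mk_union_le _ _).trans_lt h)
  refine ⟨S, hS, fun x hx => hS' x ?_⟩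
  have hμ : μ ≤ #{z // Quotient.mk γ.rel (.inl z) = Quotient.mk γ.rel (.inl x)} :=
    hx.trans_eq (mk_congr (Equiv.subtypeEquivRight fun z =>
      ⟨fun h => Quotient.eq.2 (γ.rel.symm h), fun h => γ.rel.symm (Quotient.eq.1 h)⟩))
  by_cases hy : ∃ y, Quotient.mk γ.rel (.inr y) = Quotient.mk γ.rel (.inl x)
  · exact .inl ⟨⟨⟨x, rfl⟩, hy⟩, hμ⟩
  · exact .inr ⟨fun y h => hy ⟨y, h⟩, hμ⟩

theorem smallKer_of_mem_leftSet [Nonempty X] {γ : PartitionMonoid X} (h : γ ∈ leftSet X)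
    {μ : Cardinal.{u}} (hμ : 2 ≤ μ) : γ.SmallKer μ := by
  rw [mem_leftSet_iff] at h
  refine ⟨∅, by rw [mk_eq_zero]; exact pos_iff_ne_zero.2 (mk_ne_zero X), fun x hx => ?_⟩
  obtain ⟨y, z, hyz⟩ := two_le_iff.1 (hμ.trans hx)
  exact absurd (Subtype.ext ((h.2 _ _ y.2).symm.trans (h.2 _ _ z.2))) hyz

/-- A point of an upper nontransversal of `γ * δ` either lies in one of `γ` or reaches, through `γ`,
a middle point in one of `δ`. -/
theorem SmallDefect.mul (hX : ℵ₀ ≤ #X) {γ δ : PartitionMonoid X} (hγ : γ.SmallDefect)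
    (hδ : δ.SmallDefect) : (γ * δ).SmallDefect := by
  obtain ⟨S, hS, hS'⟩ := hγ
  obtain ⟨T, hT, hT'⟩ := hδ
  obtain ⟨U, hU, hU'⟩ := exists_connected_representatives γ δ
    (ProductVertex.up '' S ∪ ProductVertex.mid '' T)
    ((mk_union_le _ _).trans_lt (add_lt_of_lt hX (mk_image_le.trans_lt hS)
      (mk_image_le.trans_lt hT)))
  refine ⟨U, hU, fun x hx => ?_⟩
  by_cases hxy : ∃ y, γ.rel (.inl x) (.inr y)
  · obtain ⟨y, hy⟩ := hxy
    have hxy' : productConn γ δ (.up x) (.mid y) := conn_top δ hy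
    obtain ⟨t, ht, hyt⟩ := hT' y fun z hz =>
      hx z ((productConn _ _).trans hxy' (conn_bottom γ hz))
    exact hU' x _ (.inr ⟨t, ht, rfl⟩) ((productConn _ _).trans hxy' (conn_bottom γ hyt))
  · obtain ⟨s, hs, hxs⟩ := hS' x (not_exists.1 hxy)
    exact hU' x _ (.inl ⟨s, hs, rfl⟩) (conn_top δ hxs)

/-- Away from the exceptional points the kernel classes met are singletons, so the component of `x`
is its block of `γ` with blocks of `δ` hanging below, and no path returns to another upper point. -/
theorem SmallKer.two_mul (hX : ℵ₀ ≤ #X) {γ δ : PartitionMonoid X} (hγ : γ.SmallKer 2)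
    (hδ : δ.SmallKer 2) : (γ * δ).SmallKer 2 := by
  obtain ⟨S, hS, hS'⟩ := hγ
  obtain ⟨T, hT, hT'⟩ := hδ
  obtain ⟨U, hU, hU'⟩ := exists_connected_representatives γ δ
    (ProductVertex.up '' S ∪ ProductVertex.mid '' T)
    ((mk_union_le _ _).trans_lt (add_lt_of_lt hX (mk_image_le.trans_lt hS)
      (mk_image_le.trans_lt hT)))
  refine ⟨U, hU, fun x hx => ?_⟩
  by_contra hcon
  have hno : ∀ v ∈ ProductVertex.up '' S ∪ ProductVertex.mid '' T,
      ¬ productConn γ δ (.up x) v := fun v hv h => hcon (hU' x v hv h)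
  have htwo : ∀ (ε : PartitionMonoid X) (a b : X), ε.rel (.inl a) (.inl b) → a ≠ b →
      2 ≤ #{z // ε.rel (.inl a) (.inl z)} := fun ε a b hab hne =>
    two_le_iff.2 ⟨⟨a, ε.rel.refl _⟩, ⟨b, hab⟩, fun h => hne (congrArg Subtype.val h)⟩
  have hγx : ∀ b, γ.rel (.inl x) (.inl b) → b = x := fun b hb => by
    by_contra hne
    obtain ⟨s, hs, hxs⟩ := hS' x (htwo γ x b hb (Ne.symm hne))
    exact hno _ (.inl ⟨s, hs, rfl⟩) (conn_top δ hxs)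
  have hδx : ∀ a b, γ.rel (.inl x) (.inr a) → δ.rel (.inl a) (.inl b) → b = a := by
    intro a b ha hab
    by_contra hne
    obtain ⟨t, ht, hat⟩ := hT' a (htwo δ a b hab (Ne.symm hne))
    exact hno _ (.inr ⟨t, ht, rfl⟩) ((productConn _ _).trans
      (conn_top (a := .inl x) (b := .inr a) δ ha) (conn_bottom γ hat))
  have hsing : ∀ z, (γ * δ).rel (.inl x) (.inl z) → z = x := fun z hz => by
    refine mul_rel_induction (fun
      | .up a => a = x
      | .mid a => γ.rel (.inl x) (.inr a)
      | .low b => ∃ a, γ.rel (.inl x) (.inr a) ∧ δ.rel (.inl a) (.inr b)) ?_ ?_ hz rfl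
    · rintro (a | a) (b | b) hab ha
      · cases ha; exact hγx _ hab
      · cases ha; exact hab
      · exact hγx _ (γ.rel.trans ha hab)
      · exact γ.rel.trans ha hab
    · rintro (a | a) (b | b) hab ha
      · exact hδx a b ha hab ▸ ha
      · exact ⟨a, ha, hab⟩
      · obtain ⟨c, hc, hca⟩ := ha
        exact hδx c b hc (δ.rel.trans hca hab) ▸ hc
      · exact ⟨ha.choose, ha.choose_spec.1, δ.rel.trans ha.choose_spec.2 hab⟩
  obtain ⟨y, z, hyz⟩ := two_le_iff.1 hx
  exact hyz (Subtype.ext ((hsing _ y.2).trans (hsing _ z.2).symm))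

theorem mk_block_le {γ : PartitionMonoid X} {μ : Cardinal.{u}} (hμ : ℵ₀ ≤ μ) {S T : Set X}
    (hS : ∀ x, μ ≤ #{z // γ.rel (.inl x) (.inl z)} → ∃ s ∈ S, γ.rel (.inl x) (.inl s))
    (hT : ∀ x, μ ≤ #{z // γ.star.rel (.inl x) (.inl z)} → ∃ s ∈ T, γ.star.rel (.inl x) (.inl s))
    {a : X ⊕ X} (haS : ∀ s ∈ S, ¬ γ.rel a (.inl s)) (haT : ∀ s ∈ T, ¬ γ.rel a (.inr s)) :
    #{b | γ.rel a b} ≤ μ := by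
  have h0 : ∀ {B : Set X}, μ ≤ #B → B.Nonempty := fun {B} h =>
    nonempty_coe_sort.1 (mk_ne_zero_iff.1 ((aleph0_pos.trans_le hμ).trans_le h).ne')
  have h1 : #{z | γ.rel a (.inl z)} ≤ μ := by
    by_contra! hlt
    obtain ⟨x, hx⟩ := h0 hlt.le
    obtain ⟨s, hs, hxs⟩ := hS x (hlt.le.trans (mk_le_mk_of_subset
      (t := {z | γ.rel (.inl x) (.inl z)}) fun z hz => γ.rel.trans (γ.rel.symm hx) hz))
    exact haS s hs (γ.rel.trans hx hxs)
  have h2 : #{z | γ.rel a (.inr z)} ≤ μ := by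
    by_contra! hlt
    obtain ⟨x, hx⟩ := h0 hlt.le
    obtain ⟨s, hs, hxs⟩ := hT x (hlt.le.trans (mk_le_mk_of_subset
      (t := {z | γ.rel (.inr x) (.inr z)}) fun z hz => γ.rel.trans (γ.rel.symm hx) hz))
    exact haT s hs (γ.rel.trans hx hxs)
  have hsub : {b | γ.rel a b} ⊆
      Sum.inl '' {z | γ.rel a (.inl z)} ∪ Sum.inr '' {z | γ.rel a (.inr z)} := by
    rintro (b | b) hb
    · exact .inl ⟨b, hb, rfl⟩
    · exact .inr ⟨b, hb, rfl⟩
  exact (mk_le_mk_of_subset hsub).trans ((mk_union_le _ _).trans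
    ((add_le_add (mk_image_le.trans h1) (mk_image_le.trans h2)).trans (add_eq_self hμ).le))

/-- A component avoiding the exceptional points passes only through blocks of size at most `μ`, so
it has at most `μ` vertices. It may reach `μ` even if all its blocks are smaller, as with finite
blocks and `μ = ℵ₀`; hence the successor. -/
theorem SmallKer.mul_succ (hX : ℵ₀ ≤ #X) {γ δ : PartitionMonoid X} {μ : Cardinal.{u}}
    (hμ : ℵ₀ ≤ μ) (hγ : γ.SmallKer μ) (hγ' : γ.star.SmallKer μ) (hδ : δ.SmallKer μ)
    (hδ' : δ.star.SmallKer μ) : (γ * δ).SmallKer (Order.succ μ) := by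
  obtain ⟨S, hS, hS'⟩ := hγ
  obtain ⟨T, hT, hT'⟩ := hγ'
  obtain ⟨S₂, hS₂, hS₂'⟩ := hδ
  obtain ⟨T₂, hT₂, hT₂'⟩ := hδ'
  set H : Set (ProductVertex X) := (ProductVertex.up '' S ∪ ProductVertex.mid '' T) ∪
    (ProductVertex.mid '' S₂ ∪ ProductVertex.low '' T₂) with hH
  have hHcard : #H < #X := (mk_union_le _ _).trans_lt (add_lt_of_lt hX
    ((mk_union_le _ _).trans_lt (add_lt_of_lt hX (mk_image_le.trans_lt hS)
      (mk_image_le.trans_lt hT)))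
    ((mk_union_le _ _).trans_lt (add_lt_of_lt hX (mk_image_le.trans_lt hS₂)
      (mk_image_le.trans_lt hT₂))))
  obtain ⟨U, hU, hU'⟩ := exists_connected_representatives γ δ H hHcard
  refine ⟨U, hU, fun x hx => ?_⟩
  by_contra hcon
  have hno : ∀ v ∈ H, ¬ productConn γ δ (.up x) v := fun v hv h => hcon (hU' x v hv h)
  have htop : ∀ a, productConn γ δ (.up x) (placeTop a) → #{b | γ.rel a b} ≤ μ := fun a ha =>
    mk_block_le hμ hS' hT'
      (fun s hs h => hno _ (.inl (.inl ⟨s, hs, rfl⟩)) ((productConn _ _).trans ha (conn_top δ h)))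
      (fun s hs h => hno _ (.inl (.inr ⟨s, hs, rfl⟩)) ((productConn _ _).trans ha (conn_top δ h)))
  have hbot : ∀ a, productConn γ δ (.up x) (placeBottom a) → #{b | δ.rel a b} ≤ μ := fun a ha =>
    mk_block_le hμ hS₂' hT₂'
      (fun s hs h => hno _ (.inr (.inl ⟨s, hs, rfl⟩))
        ((productConn _ _).trans ha (conn_bottom γ h)))
      (fun s hs h => hno _ (.inr (.inr ⟨s, hs, rfl⟩))
        ((productConn _ _).trans ha (conn_bottom γ h)))
  have hcomp : #{w | Relation.ReflTransGen (ProductEdge γ δ) (.up x) w} ≤ μ := by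
    refine mk_reflTransGen_le hμ _ fun v hv => ?_
    have hsub : {w | ProductEdge γ δ v w} ⊆
        {w | ∃ a b, v = placeTop a ∧ w = placeTop b ∧ γ.rel a b} ∪
        {w | ∃ a b, v = placeBottom a ∧ w = placeBottom b ∧ δ.rel a b} := by
      intro w hw
      cases hw with
      | top h => exact .inl ⟨_, _, rfl, rfl, h⟩
      | bottom h => exact .inr ⟨_, _, rfl, rfl, h⟩
    refine (mk_le_mk_of_subset hsub).trans ((mk_union_le _ _).trans
      ((add_le_add ?_ ?_).trans (add_eq_self hμ).le))
    · by_cases hva : ∃ a, v = placeTop a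
      · obtain ⟨a, rfl⟩ := hva
        refine (mk_le_mk_of_subset (t := placeTop '' {b | γ.rel a b}) ?_).trans
          (mk_image_le.trans (htop a hv))
        rintro _ ⟨a', b, ha, rfl, hab⟩
        exact ⟨b, placeTop_injective ha ▸ hab, rfl⟩
      · refine (mk_le_mk_of_subset (t := ∅) ?_).trans (by simp)
        rintro _ ⟨a, b, ha, -⟩
        exact hva ⟨a, ha⟩
    · by_cases hva : ∃ a, v = placeBottom a
      · obtain ⟨a, rfl⟩ := hva
        refine (mk_le_mk_of_subset (t := placeBottom '' {b | δ.rel a b}) ?_).trans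
          (mk_image_le.trans (hbot a hv))
        rintro _ ⟨a', b, ha, rfl, hab⟩
        exact ⟨b, placeBottom_injective ha ▸ hab, rfl⟩
      · refine (mk_le_mk_of_subset (t := ∅) ?_).trans (by simp)
        rintro _ ⟨a, b, ha, -⟩
        exact hva ⟨a, ha⟩
  have h1 : #{z // (γ * δ).rel (.inl x) (.inl z)} ≤ μ :=
    (mk_le_of_injective (β := {w | Relation.ReflTransGen (ProductEdge γ δ) (.up x) w})
      (f := fun z => ⟨.up z.1, z.2⟩) fun y z h =>
        Subtype.ext (ProductVertex.up.inj (congrArg Subtype.val h))).trans hcomp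
  exact absurd (hx.trans h1) (not_le.2 (Order.lt_succ μ))

theorem exists_not_smallDefect : ∃ γ : PartitionMonoid X, ¬ γ.SmallDefect := by
  refine ⟨⟨⊥⟩, fun ⟨S, hS, h⟩ => hS.not_ge ?_⟩
  rw [← mk_univ]
  refine mk_le_mk_of_subset fun x _ => ?_
  obtain ⟨s, hs, hxs⟩ := h x fun y hy => nomatch (hy : Sum.inl x = Sum.inr y)
  have : Sum.inl x = Sum.inl s := hxs
  rwa [Sum.inl_injective this]

/-- Splitting `X` as `X × X` gives `#X` kernel classes, each of size `#X`, which defeats all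
thresholds at once. -/
theorem exists_not_smallKer (hX : ℵ₀ ≤ #X) :
    ∃ γ : PartitionMonoid X, ∀ μ ≤ #X, ¬ γ.SmallKer μ := by
  obtain ⟨e⟩ : Nonempty (X ≃ X × X) := Cardinal.eq.1 (by rw [mk_prod, lift_id, mul_eq_self hX])
  refine ⟨⟨Setoid.ker (Sum.elim (fun x => (e x).1) id)⟩, fun μ hμ ⟨S, hS, h⟩ => hS.not_ge ?_⟩
  refine mk_le_of_surjective (f := fun s : S => (e s).1) fun x => ?_
  have hfib : ∀ y, (e (e.symm (x, x))).1 = (e (e.symm (x, y))).1 := fun y => by simp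
  obtain ⟨s, hs, hxs⟩ := h (e.symm (x, x)) (hμ.trans (mk_le_of_injective
    (f := fun y => ⟨e.symm (x, y), hfib y⟩)
    fun y z hyz => by simpa using congrArg Subtype.val hyz))
  refine ⟨⟨s, hs⟩, ?_⟩
  have : (e (e.symm (x, x))).1 = (e s).1 := hxs
  simpa using this.symm

theorem exists_mem_leftSet_notMem_units (hX : ℵ₀ ≤ #X) :
    ∃ γ ∈ leftSet X, γ ∉ units X := by
  obtain ⟨e⟩ : Nonempty (X ≃ X ⊕ X) :=
    Cardinal.eq.1 (by rw [mk_sum, lift_id, add_eq_self hX])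
  refine ⟨⟨Setoid.ker (Sum.elim Sum.inl e)⟩, mem_leftSet_iff.2
    ⟨fun y => ⟨e.symm (.inl y), ?_⟩, fun y z h => Sum.inl_injective h⟩, fun h => ?_⟩
  · exact (e.apply_symm_apply _).symm
  · obtain ⟨x⟩ : Nonempty X := mk_ne_zero_iff.1 (aleph0_pos.trans_le hX).ne'
    obtain ⟨y, hy⟩ := (mem_rightSet_iff.1 (mem_units_iff.1 h).2).1 (e.symm (.inr x))
    have hy' : e (e.symm (.inr x)) = Sum.inl y := hy
    simp at hy'

/-! ### What generation forces on the two generators. -/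

variable {α β : PartitionMonoid X}

theorem of_closure_eq_top (h : Subsemigroup.closure (units X ∪ {α, β}) = ⊤)
    (P : PartitionMonoid X → Prop) (hu : ∀ π ∈ units X, P π) (hα : P α) (hβ : P β)
    (hmul : ∀ γ δ, P γ → P δ → P (γ * δ)) (γ : PartitionMonoid X) : P γ := by
  have hγ : γ ∈ Subsemigroup.closure (units X ∪ {α, β}) := h ▸ Subsemigroup.mem_top γ
  induction hγ using Subsemigroup.closure_induction with
  | mem δ hδ => rcases hδ with hδ | rfl | rfl; exacts [hu δ hδ, hα, hβ]
  | mul δ ε _ _ h1 h2 => exact hmul δ ε h1 h2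

/-- Otherwise every element of `L_X` would be a unit: if `γ * δ` is in `L_X` then so is `γ`, which
is therefore a unit and can be cancelled, leaving `δ` in `L_X`. -/
theorem leftSet_of_closure_eq_top (hX : ℵ₀ ≤ #X)
    (h : Subsemigroup.closure (units X ∪ {α, β}) = ⊤) :
    (α ∈ leftSet X ∧ α ∉ units X) ∨ (β ∈ leftSet X ∧ β ∉ units X) := by
  by_contra! hcon
  obtain ⟨γ, hγ, hγ'⟩ := exists_mem_leftSet_notMem_units hX
  refine hγ' (of_closure_eq_top h (fun γ => γ ∈ leftSet X → γ ∈ units X) (fun _ h _ => h)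
    hcon.1 hcon.2 (fun γ δ hγ hδ hγδ => ?_) γ hγ)
  obtain ⟨π, rfl⟩ := (mem_units_iff.1 (hγ (mem_leftSet_of_mul hγδ))).elim exists_perm_eq
  have hδ' : δ ∈ leftSet X := by
    have := mul_mem_leftSet (units_subset_leftSet (perm_mem_units π.symm)) hγδ
    rwa [← mul_assoc, perm_mul_perm, Equiv.symm_trans_self, perm_refl, one_mul] at this
  exact (perm_mem_units π).mul (hδ hδ')

theorem rightSet_of_closure_eq_top (hX : ℵ₀ ≤ #X)
    (h : Subsemigroup.closure (units X ∪ {α, β}) = ⊤) :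
    (α ∈ rightSet X ∧ α ∉ units X) ∨ (β ∈ rightSet X ∧ β ∉ units X) := by
  have hu : ∀ γ : PartitionMonoid X, γ.star ∉ units X → γ ∉ units X :=
    fun γ h h' => h (star_mem_units h')
  rcases leftSet_of_closure_eq_top hX (closure_star h) with h | h
  · exact .inr ⟨h.1, hu _ h.2⟩
  · exact .inl ⟨h.1, hu _ h.2⟩

theorem d_of_closure_eq_top (hX : ℵ₀ ≤ #X)
    (h : Subsemigroup.closure (units X ∪ {α, β}) = ⊤) (hα : α ∈ leftSet X) : β.d 1 = #X := by
  have : Nonempty X := mk_ne_zero_iff.1 (aleph0_pos.trans_le hX).ne'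
  by_contra hne
  obtain ⟨γ, hγ⟩ := exists_not_smallDefect (X := X)
  exact hγ (of_closure_eq_top h _
    (fun π hπ => smallDefect_of_mem_leftSet (units_subset_leftSet hπ))
    (smallDefect_of_mem_leftSet hα) (smallDefect_of_d_lt ((d_le hX β 1).lt_of_ne hne))
    (fun _ _ h1 h2 => h1.mul hX h2) γ)

theorem smallKer_of_ne (hX : ℵ₀ ≤ #X) {γ : PartitionMonoid X} {μ : Cardinal.{u}}
    (h : γ.k μ + γ.d μ ≠ #X) : γ.SmallKer μ :=
  smallKer_of_lt (((add_le_add (k_le hX γ μ) (d_le hX γ μ)).trans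
    (add_eq_self hX).le).lt_of_ne h)

theorem k_two_of_closure_eq_top (hX : ℵ₀ ≤ #X)
    (h : Subsemigroup.closure (units X ∪ {α, β}) = ⊤) (hα : α ∈ leftSet X) :
    β.k 2 + β.d 2 = #X := by
  have : Nonempty X := mk_ne_zero_iff.1 (aleph0_pos.trans_le hX).ne'
  by_contra hne
  obtain ⟨γ, hγ⟩ := exists_not_smallKer hX
  exact hγ 2 (((natCast_lt_aleph0 (n := 2)).trans_le hX).le) (of_closure_eq_top h (fun γ => γ.SmallKer 2)
    (fun π hπ => smallKer_of_mem_leftSet (units_subset_leftSet hπ) le_rfl)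
    (smallKer_of_mem_leftSet hα le_rfl) (smallKer_of_ne hX hne)
    (fun _ _ h1 h2 => h1.two_mul hX h2) γ)

theorem k_of_closure_eq_top (hX : (#X).IsSingular)
    (h : Subsemigroup.closure (units X ∪ {α, β}) = ⊤) (hα : α ∈ leftSet X)
    (hβ : β ∈ rightSet X) :
    (∀ μ < #X, β.k μ + β.d μ = #X) ∨ ∀ μ < #X, α.kStar μ + α.dStar μ = #X := by
  have hinf := hX.aleph0_le
  have : Nonempty X := mk_ne_zero_iff.1 (aleph0_pos.trans_le hinf).ne'
  by_contra! hcon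
  obtain ⟨⟨μ, hμ, hβμ⟩, ν, hν, hαν⟩ := hcon
  have hlt : ℵ₀ < #X := hinf.lt_of_ne fun h => not_isSingular_aleph0 (h ▸ hX)
  rw [← k_star, ← d_star] at hαν
  have h2 : (2 : Cardinal.{u}) ≤ ℵ₀ := (natCast_lt_aleph0 (n := 2)).le
  obtain ⟨γ, hγ⟩ := exists_not_smallKer hinf
  obtain ⟨ξ, hξ, -, hξ', -⟩ := of_closure_eq_top h
    -- The threshold is part of the invariant because it grows with each product; both rows are
    -- needed since paths in a product graph use kernels and cokernels alike.
    (fun γ => ∃ ξ < #X, ℵ₀ ≤ ξ ∧ γ.SmallKer ξ ∧ γ.star.SmallKer ξ)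
    (fun π hπ => ⟨ℵ₀, hlt, le_rfl, smallKer_of_mem_leftSet (units_subset_leftSet hπ) h2,
      smallKer_of_mem_leftSet (units_subset_leftSet (star_mem_units hπ)) h2⟩)
    ⟨max ν ℵ₀, max_lt hν hlt, le_max_right _ _,
      smallKer_of_mem_leftSet hα (h2.trans (le_max_right _ _)),
      (smallKer_of_ne hinf hαν).mono (le_max_left _ _)⟩
    ⟨max μ ℵ₀, max_lt hμ hlt, le_max_right _ _, (smallKer_of_ne hinf hβμ).mono (le_max_left _ _),
      smallKer_of_mem_leftSet (star_mem_leftSet.2 hβ) (h2.trans (le_max_right _ _))⟩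
    (fun γ δ ⟨μ, hμ, hμ₀, h1, h2⟩ ⟨ν, hν, _, h3, h4⟩ => by
      have hm := hμ₀.trans (le_max_left μ ν)
      have h1 := h1.mono (le_max_left μ ν)
      have h2 := h2.mono (le_max_left μ ν)
      have h3 := h3.mono (le_max_right μ ν)
      have h4 := h4.mono (le_max_right μ ν)
      refine ⟨Order.succ (max μ ν), hX.isSuccLimit.succ_lt (max_lt hμ hν),
        hm.trans (Order.le_succ _), h1.mul_succ hinf hm h2 h3 h4, ?_⟩
      rw [star_mul]
      exact h4.mul_succ hinf hm (by rwa [star_star]) h2 (by rwa [star_star])) γ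
  exact hγ ξ hξ.le hξ'

theorem conditions_of_closure_eq_top (hX : (#X).IsSingular)
    (h : Subsemigroup.closure (units X ∪ {α, β}) = ⊤) (hα : α ∈ leftSet X)
    (hβ : β ∈ rightSet X) :
    α.dStar 1 = #X ∧ β.d 1 = #X ∧
      ((α.kStar 2 + α.dStar 2 = #X ∧ ∀ μ < #X, β.k μ + β.d μ = #X) ∨
        ((∀ μ < #X, α.kStar μ + α.dStar μ = #X) ∧ β.k 2 + β.d 2 = #X)) := by
  have hinf := hX.aleph0_le
  have h' := closure_star h
  have hβ' := star_mem_leftSet.2 hβ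
  have h2 := k_two_of_closure_eq_top hinf h' hβ'
  rw [k_star, d_star] at h2
  refine ⟨by rw [← d_star]; exact d_of_closure_eq_top hinf h' hβ',
    d_of_closure_eq_top hinf h hα, ?_⟩
  rcases k_of_closure_eq_top hX h hα hβ with h3 | h3
  · exact .inl ⟨h2, h3⟩
  · exact .inr ⟨h3, k_two_of_closure_eq_top hinf h hα⟩

theorem closure_eq_top_of_conditions (hX : (#X).IsSingular) (hα : α ∈ leftSet X)
    (hβ : β ∈ rightSet X) (hdα : α.dStar 1 = #X) (hdβ : β.d 1 = #X)
    (h : (α.kStar 2 + α.dStar 2 = #X ∧ ∀ μ < #X, β.k μ + β.d μ = #X) ∨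
        ((∀ μ < #X, α.kStar μ + α.dStar μ = #X) ∧ β.k 2 + β.d 2 = #X)) :
    Subsemigroup.closure (units X ∪ {α, β}) = ⊤ := by
  rcases h with ⟨h1, h2⟩ | ⟨h1, h2⟩
  · exact closure_eq_top hX hα hβ hdα hdβ h1 h2
  · have := closure_star (closure_eq_top hX (star_mem_leftSet.2 hβ) (star_mem_rightSet.2 hα)
      (by rw [dStar_star, hdβ]) (by rw [d_star, hdα]) (by rw [kStar_star, dStar_star, h2])
      (fun μ hμ => by rw [k_star, d_star, h1 μ hμ]))
    rwa [star_star, star_star] at this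

end PartitionMonoid

end

/-! ### The characterisation. -/

theorem mainTheorem4 {X : Type u} (hX : (Cardinal.mk X).IsSingular) (α β : PartitionMonoid X) :
    Subsemigroup.closure (PartitionMonoid.units X ∪ {α, β}) = ⊤ ↔
      ∃ γ δ : PartitionMonoid X, ((γ = α ∧ δ = β) ∨ (γ = β ∧ δ = α)) ∧
        γ ∈ PartitionMonoid.leftSet X ∧ δ ∈ PartitionMonoid.rightSet X ∧
        γ.dStar 1 = Cardinal.mk X ∧ δ.d 1 = Cardinal.mk X ∧
        ((γ.kStar 2 + γ.dStar 2 = Cardinal.mk X ∧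
            ∀ μ : Cardinal.{u}, μ < Cardinal.mk X → δ.k μ + δ.d μ = Cardinal.mk X) ∨
          ((∀ μ : Cardinal.{u}, μ < Cardinal.mk X → γ.kStar μ + γ.dStar μ = Cardinal.mk X) ∧
            δ.k 2 + δ.d 2 = Cardinal.mk X)) := by
  have hinf := hX.aleph0_le
  constructor
  · intro h
    have hr := PartitionMonoid.rightSet_of_closure_eq_top hinf h
    rcases PartitionMonoid.leftSet_of_closure_eq_top hinf h with ⟨hα, hα'⟩ | ⟨hβ, hβ'⟩
    -- An element of both `L_X` and `R_X` is a unit, so the nonunits found in the two sets are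
    -- different generators.
    · have hβ : β ∈ PartitionMonoid.rightSet X := hr.elim
        (fun h => absurd (PartitionMonoid.mem_units_iff.2 ⟨hα, h.1⟩) hα') And.left
      exact ⟨α, β, .inl ⟨rfl, rfl⟩, hα, hβ,
        PartitionMonoid.conditions_of_closure_eq_top hX h hα hβ⟩
    · have hα : α ∈ PartitionMonoid.rightSet X := hr.elim And.left
        (fun h => absurd (PartitionMonoid.mem_units_iff.2 ⟨hβ, h.1⟩) hβ')
      rw [Set.pair_comm] at h
      exact ⟨β, α, .inr ⟨rfl, rfl⟩, hβ, hα,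
        PartitionMonoid.conditions_of_closure_eq_top hX h hβ hα⟩
  · rintro ⟨γ, δ, ⟨rfl, rfl⟩ | ⟨rfl, rfl⟩, hγ, hδ, hdγ, hdδ, h⟩
    · exact PartitionMonoid.closure_eq_top_of_conditions hX hγ hδ hdγ hdδ h
    · rw [Set.pair_comm]
      exact PartitionMonoid.closure_eq_top_of_conditions hX hγ hδ hdγ hdδ h
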